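/- Graphs are finite, nonnull and loopless, and multiple edges are allowed. $d_G(v)$ is the number of edges of $G$ incident to $v$. A graph is $k$-edge-connected if for every nonempty proper subset $S$ of its vertex set at least $k$ edges have exactly one end in $S$, and it is $m$-tree-connected if it contains $m$ pairwise edge-disjoint spanning trees. A vertex set is independent if no edge joins two of its vertices. Theorem. Let $m,k$ be positive integers, let $G$ be a graph and let $X\subseteq V(G)$. (1) If $G$ is $k$-edge-connected and $k\ge 2m$, then $G$ has an $m$-tree-connected spanning subgraph $H$ such that $d_H(v)\le\left\lceil\frac{m}{k}(d_G(v)-2m)\right\rceil+2m$ for each $v\in X$. (2) If $G$ is $k$-tree-connected and $k\ge m$, then $G$ has an $m$-tree-connected spanning subgraph $H$ such that $d_H(v)\le\left\lceil\frac{m}{k}(d_G(v)-m)\right\rceil+m$ for each $v\in X$. (3) If $G$ is $k$-edge-connected, $k\ge 2m$ and $X$ is independent, then $G$ has an $m$-tree-connected spanning subgraph $H$ such that $d_H(v)\le\left\lceil\frac{m}{k}d_G(v)\right\rceil+m$ for each $v\in X$. (4) If $G$ is $k$-tree-connected, $k\ge m$ and $X$ is independent, then $G$ has an $m$-tree-connected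 spanning subgraph $H$ such that $d_H(v)\le\left\lceil\frac{m}{k}d_G(v)\right\rceil$ for each $v\in X$. Furthermore, in each of the four cases, for any given vertex $u\in V(G)$ the subgraph $H$ can be chosen so that in addition $d_H(u)\le\left\lfloor\frac{m}{k}d_G(u)\right\rfloor$. -/

import Mathlib

/-! Multigraphs are Mathlib's `Graph α β`: a vertex set in `α`, an edge set in `β`, parallel edges
allowed. The definitions of degree and edge cut below count every edge once; they are used for
loopless graphs only. -/

namespace Graph

variable {α β : Type*}

/-- The degree of `v`: the number of edges of `G` incident to `v` (for a loopless finite `G`). -/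
noncomputable def deg (G : Graph α β) (v : α) : ℕ := (G.incidenceSet v).ncard

/-- The set of edges of `G` with exactly one end in `S`. -/
def cut (G : Graph α β) (S : Set α) : Set β := {e | ∃ x ∈ S, ∃ y ∉ S, G.IsLink e x y}

/-- `G` is `k`-edge-connected: it is nonnull, and every nonempty proper subset of its vertex set is
left by at least `k` edges. -/
def IsEdgeConnected (G : Graph α β) (k : ℕ) : Prop :=
  G.vertexSet.Nonempty ∧
    ∀ S : Set α, S ⊆ G.vertexSet → S.Nonempty → S ≠ G.vertexSet → k ≤ (G.cut S).ncard

/-- `G` is connected: it is nonnull, and any two of its vertices are joined by a walk. -/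
def IsConnected (G : Graph α β) : Prop :=
  G.vertexSet.Nonempty ∧
    ∀ x ∈ G.vertexSet, ∀ y ∈ G.vertexSet, Relation.ReflTransGen G.Adj x y

/-- `G` contains a cycle of length `n + 1`: distinct vertices `v 0, …, v n` and distinct edges
`e 0, …, e n` such that `e i` joins `v i` and `v (i + 1)`, where `i + 1` is taken cyclically.
A loop is a cycle of length one and a pair of parallel edges is a cycle of length two. -/
def HasCycle (G : Graph α β) : Prop :=
  ∃ (n : ℕ) (v : Fin (n + 1) → α) (e : Fin (n + 1) → β),
    Function.Injective v ∧ Function.Injective e ∧ ∀ i, G.IsLink (e i) (v i) (v (i + 1))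

/-- A tree is a connected graph without cycles. -/
def IsTree (G : Graph α β) : Prop := G.IsConnected ∧ ¬ G.HasCycle

/-- `G` is `m`-tree-connected: it has `m` pairwise edge-disjoint spanning trees. -/
def IsTreeConnected (G : Graph α β) (m : ℕ) : Prop :=
  ∃ T : Fin m → Graph α β, (∀ i, (T i).IsSpanningSubgraph G ∧ (T i).IsTree) ∧
    ∀ i j, i ≠ j → Disjoint (T i).edgeSet (T j).edgeSet

/-- `X` is independent in `G`: no edge of `G` joins two vertices of `X`. -/
def IsIndependent (G : Graph α β) (X : Set α) : Prop := ∀ x ∈ X, ∀ y ∈ X, ¬ G.Adj x y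

end Graph

/-! Orient every edge `e` arbitrarily from `s e` to `t e` and relax packings of spanning trees to
weights `x : E → ℝ` with values in `[0, 1]`, total `m * (|V| - 1)`, and at most `m * (|A| - 1)`
inside each nonempty vertex set `A` (`IsFracBase`). The integral points are exactly the bases
sought: `exists_disjoint_trees` splits them into `m` disjoint spanning trees. The hypotheses enter
only through a fractional base `z` that puts little weight on the edges touching a vertex set `S`.
With `q = m / k` this weight is at most `a * |S \ {u}| + q * ∑_S d_G - l * e(S)`, where `e(S)`
counts the edges inside `S`.

For `k` disjoint trees, `z` is `m / k` times the sum of their indicators, and `a = 0`, `l = m / k`.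
For a `k`-edge-connected graph, replace each edge by two opposite arcs of weight `m / k`, so that
weight at least `m` enters every set avoiding `u`. A minimal such weighting enters each vertex other
than `u` with weight exactly `m` and `u` with weight zero (`exists_arc_weights`); adding opposite
arcs gives `z` with `a = m`, `l = 2m / k`. Excluding the root `u` from the `a`-term is what yields
the floor bound at `u`.

For general `X`, an exchange argument (`exists_base_degree_le_or`) shows that if no base meets the
degree bounds, then some base `H` has a set `S` of full vertices, one of them overfull, while `H`
has no more weight touching `S` than `z`. The degree sum of `H` over `S` is its touching count plus
its inside count. The inside count is at most both `e(S)` and `m * |S \ {u}|`, hence at most their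
convex combination with coefficients `l` and `1 - l`. The resulting upper bound contradicts
overfullness (`exists_base_degree_le`).

For independent `X`, the stars of the vertices of `X` are disjoint. Tight sparsity constraints
reduce to a partition of the edges, and tight degree constraints form a partial partition. Two such
families of classes cannot isolate a fractional extreme point, so the polytope with degree bounds
has an integral point whose degree at `u` is no larger than that of `z`
(`exists_base_of_independent`). The term `m * (1 - l)` then disappears. The same two-partition
argument splits off one tree at a time in `exists_split`. -/

set_option linter.unusedSectionVars false

/-! ### Sparse weights, tight sets and uncrossing. -/

namespace EdgeSparse

open Finset

variable {V E : Type*} [Fintype E] [DecidableEq V] [DecidableEq E] {s t : E → V}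

/-- The edges with both ends in `A`, where the edge `e` joins `s e` and `t e`. -/
def inside (s t : E → V) (A : Finset V) : Finset E := univ.filter fun e => s e ∈ A ∧ t e ∈ A

/-- The edges with an end equal to `v`. -/
def star (s t : E → V) (v : V) : Finset E := univ.filter fun e => s e = v ∨ t e = v

/-- The indicator function of a set of edges. -/
def ind (H : Finset E) (e : E) : ℝ := if e ∈ H then 1 else 0

/-- Every nonempty vertex set `A` has total weight at most `m * (|A| - 1)` inside. -/
def IsSparse (s t : E → V) (m : ℕ) (x : E → ℝ) : Prop :=
  ∀ A : Finset V, A.Nonempty → ∑ e ∈ inside s t A, x e ≤ m * ((#A : ℝ) - 1)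

/-- Equality holds at `A` in the sparsity condition. -/
def IsTight (s t : E → V) (m : ℕ) (x : E → ℝ) (A : Finset V) : Prop :=
  A.Nonempty ∧ ∑ e ∈ inside s t A, x e = m * ((#A : ℝ) - 1)

/-- A point of the base polytope of the `m`-fold union of the graphic matroid. -/
structure IsFracBase [Fintype V] (s t : E → V) (m : ℕ) (x : E → ℝ) : Prop where
  nonneg : ∀ e, 0 ≤ x e
  le_one : ∀ e, x e ≤ 1
  sparse : IsSparse s t m x
  tight : IsTight s t m x univ

@[simp] lemma mem_inside {A : Finset V} {e : E} : e ∈ inside s t A ↔ s e ∈ A ∧ t e ∈ A := by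
  simp [inside]

@[simp] lemma mem_star {v : V} {e : E} : e ∈ star s t v ↔ s e = v ∨ t e = v := by
  simp [star]

@[simp] lemma inside_univ [Fintype V] : inside s t univ = univ := by ext; simp

lemma inside_mono {A B : Finset V} (h : A ⊆ B) : inside s t A ⊆ inside s t B := fun e he => by
  rw [mem_inside] at *; exact ⟨h he.1, h he.2⟩

lemma inside_inter (A B : Finset V) :
    inside s t A ∩ inside s t B = inside s t (A ∩ B) := by
  ext; simp; tauto

lemma ind_nonneg (H : Finset E) (e : E) : 0 ≤ ind H e := by unfold ind; split_ifs <;> simp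

lemma ind_le_one (H : Finset E) (e : E) : ind H e ≤ 1 := by unfold ind; split_ifs <;> simp

lemma sum_ind (H S : Finset E) : ∑ e ∈ S, ind H e = #(H ∩ S) := by
  simp [ind, Finset.sum_ite_mem, Finset.inter_comm]

/-- The weight inside a set is supermodular and `m * (|A| - 1)` is modular on intersecting pairs, so
tightness at `A` and `B` forces equality throughout. The supermodular defect is the weight of edges
inside the union but inside neither set, which must therefore vanish. -/
lemma IsTight.uncross {m : ℕ} {x : E → ℝ} (hx : ∀ e, 0 ≤ x e) (hs : IsSparse s t m x)
    {A B : Finset V} (hA : IsTight s t m x A) (hB : IsTight s t m x B) (hAB : (A ∩ B).Nonempty) :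
    IsTight s t m x (A ∪ B) ∧ IsTight s t m x (A ∩ B) ∧
      ∀ e ∈ inside s t (A ∪ B), 0 < x e → e ∈ inside s t A ∨ e ∈ inside s t B := by
  have hU : (A ∪ B).Nonempty := hA.1.mono subset_union_left
  have h1 := hs _ hU
  have h2 := hs _ hAB
  have hc : (#(A ∪ B) : ℝ) + #(A ∩ B) = #A + #B := by exact_mod_cast card_union_add_card_inter A B
  have h3 := sum_union_inter (s₁ := inside s t A) (s₂ := inside s t B) (f := x)
  rw [inside_inter] at h3
  have hsub : inside s t A ∪ inside s t B ⊆ inside s t (A ∪ B) :=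
    union_subset (inside_mono subset_union_left) (inside_mono subset_union_right)
  have h4 := sum_sdiff hsub (f := x)
  have h5 : 0 ≤ ∑ e ∈ inside s t (A ∪ B) \ (inside s t A ∪ inside s t B), x e :=
    sum_nonneg fun e _ => hx e
  have hc' : (m : ℝ) * (#(A ∪ B) - 1) + m * (#(A ∩ B) - 1) = m * (#A - 1) + m * (#B - 1) := by
    linear_combination (m : ℝ) * hc
  have hA2 := hA.2
  have hB2 := hB.2
  refine ⟨⟨hU, by linarith⟩, ⟨hAB, by linarith⟩, fun e he hpos => ?_⟩
  by_contra hcon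
  have hmem : e ∈ inside s t (A ∪ B) \ (inside s t A ∪ inside s t B) :=
    mem_sdiff.2 ⟨he, fun h => hcon (mem_union.1 h)⟩
  have h6 := single_le_sum (f := x) (fun i _ => hx i) hmem
  linarith

/-- The edges covered by a family of vertex sets closed under unions of intersecting members are
partitioned by the maximal members. -/
lemma exists_sum_covered [Fintype V] (P : Finset V → Prop)
    (hU : ∀ A B, P A → P B → (A ∩ B).Nonempty → P (A ∪ B)) :
    ∃ 𝓜 : Finset (Finset V), (∀ A ∈ 𝓜, P A) ∧
      ∀ C : Finset E, (∀ e, e ∈ C ↔ ∃ A, P A ∧ e ∈ inside s t A) →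
        ∀ g : E → ℝ, ∑ e ∈ C, g e = ∑ A ∈ 𝓜, ∑ e ∈ inside s t A, g e := by
  classical
  refine ⟨univ.filter fun A => Maximal P A, fun A hA => (mem_filter.1 hA).2.1, fun C hC g => ?_⟩
  rw [← sum_biUnion]
  · apply sum_congr _ fun _ _ => rfl
    ext e
    simp only [hC, mem_filter, mem_univ, true_and, mem_biUnion]
    constructor
    · rintro ⟨A, hA, he⟩
      obtain ⟨B, hAB, hB⟩ := (univ.filter P).exists_le_maximal (a := A) (by simpa using hA)
      exact ⟨B, by simpa using hB, inside_mono hAB he⟩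
    · rintro ⟨A, hA, he⟩
      exact ⟨A, hA.1, he⟩
  · intro A hA B hB hne
    rw [mem_coe, mem_filter] at hA hB
    refine disjoint_left.2 fun e heA heB => hne ?_
    have h := hU A B hA.2.1 hB.2.1
      ⟨s e, mem_inter.2 ⟨(mem_inside.1 heA).1, (mem_inside.1 heB).1⟩⟩
    exact (hA.2.eq_of_le h subset_union_left).trans (hB.2.eq_of_le h subset_union_right).symm

/-- The covered edges split over the maximal tight subsets of `U`, where `H` attains the largest
weight allowed to `z`. The uncovered edges all lie in `H`, and `z ≤ 1` there. -/
lemma sum_inside_le [Fintype V] {m : ℕ} {z : E → ℝ} (hz1 : ∀ e, z e ≤ 1)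
    (hz : IsSparse s t m z) {H : Finset E}
    (hH : IsSparse s t m (ind H)) (U : Finset V)
    (h : ∀ e ∈ inside s t U, e ∉ H → ∃ A ⊆ U, IsTight s t m (ind H) A ∧ e ∈ inside s t A) :
    ∑ e ∈ inside s t U, z e ≤ ∑ e ∈ inside s t U, ind H e := by
  classical
  obtain ⟨𝓜, hM, hsum⟩ := exists_sum_covered (s := s) (t := t)
    (fun A => A ⊆ U ∧ IsTight s t m (ind H) A) fun A B hA hB hAB =>
      ⟨union_subset hA.1 hB.1, (hA.2.uncross (ind_nonneg H) hH hB.2 hAB).1⟩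
  set C := univ.filter fun e => ∃ A, (A ⊆ U ∧ IsTight s t m (ind H) A) ∧ e ∈ inside s t A with hC
  specialize hsum C (by simp [hC])
  have hCU : C ⊆ inside s t U := by
    intro e he
    simp only [hC, mem_filter, mem_univ, true_and] at he
    obtain ⟨A, ⟨hA, -⟩, he⟩ := he
    exact inside_mono hA he
  rw [← sum_sdiff hCU, ← sum_sdiff hCU (f := ind H), hsum, hsum]
  apply add_le_add
  · apply sum_le_sum fun e he => ?_
    rw [mem_sdiff] at he
    have : e ∈ H := by
      by_contra hc
      obtain ⟨A, h1, h2, h3⟩ := h e he.1 hc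
      exact he.2 (mem_filter.2 ⟨mem_univ e, A, ⟨h1, h2⟩, h3⟩)
    simpa [ind, this] using hz1 e
  · apply sum_le_sum fun A hA => ?_
    rw [(hM A hA).2.2]
    exact hz A (hM A hA).2.1

lemma IsSparse.mono {m : ℕ} {x y : E → ℝ} (hy : IsSparse s t m y) (h : ∀ e, x e ≤ y e) :
    IsSparse s t m x := fun A hA => (sum_le_sum fun e _ => h e).trans (hy A hA)

lemma isSparse_zero (m : ℕ) : IsSparse s t m 0 := fun A hA => by
  have : (1 : ℝ) ≤ #A := by exact_mod_cast hA.card_pos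
  simp only [Pi.zero_apply, sum_const_zero]
  exact mul_nonneg m.cast_nonneg (by linarith)

/-- If a sparse edge set does not stay sparse, then the loss is visible at a tight set. -/
lemma isSparse_exchange {m : ℕ} {H : Finset E} (hH : IsSparse s t m (ind H)) {e : E} (K : Finset E)
    (hK : K ⊆ insert e H)
    (h : ∀ A, IsTight s t m (ind H) A → e ∈ inside s t A → ∃ f ∈ inside s t A, f ∈ H ∧ f ∉ K) :
    IsSparse s t m (ind K) := by
  intro A hA
  have h1 := hH A hA
  rw [sum_ind] at h1 ⊢
  have hsub : K ∩ inside s t A ⊆ insert e (H ∩ inside s t A) := by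
    intro f hf
    have := hK (mem_inter.1 hf).1
    simp only [mem_insert, mem_inter] at *
    tauto
  have hcard := (card_le_card hsub).trans (card_insert_le _ _)
  by_cases hT : IsTight s t m (ind H) A
  · by_cases he : e ∈ inside s t A
    · obtain ⟨f, hfA, hfH, hfK⟩ := h A hT he
      refine le_trans ?_ h1
      by_cases heK : e ∈ H
      · have : K ∩ inside s t A ⊆ H ∩ inside s t A := by
          rw [insert_eq_self.2 heK] at hK
          exact inter_subset_inter_right hK
        exact_mod_cast card_le_card this
      have hsub : K ∩ inside s t A ⊆ insert e ((H ∩ inside s t A).erase f) := by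
        intro g hg
        have h2 := hK (mem_inter.1 hg).1
        simp only [mem_insert, mem_inter, mem_erase] at *
        rcases h2 with h2 | h2
        · exact .inl h2
        · exact .inr ⟨fun h => hfK (h ▸ hg.1), h2, hg.2⟩
      have hcard := (card_le_card hsub).trans (card_insert_le _ _)
      rw [card_erase_add_one (mem_inter.2 ⟨hfH, hfA⟩)] at hcard
      exact_mod_cast hcard
    · refine le_trans ?_ h1
      have : K ∩ inside s t A ⊆ H ∩ inside s t A := by
        intro f hf
        have h2 := hsub hf
        rcases mem_insert.1 h2 with rfl | h2
        · exact absurd (mem_inter.1 hf).2 he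
        · exact h2
      exact_mod_cast card_le_card this
  · have hlt : (#(H ∩ inside s t A) : ℝ) < m * (#A - 1) :=
      lt_of_le_of_ne h1 fun h => hT ⟨hA, by rw [sum_ind, h]⟩
    -- Both sides are integers, so a set that is not tight has room for one more edge.
    have hlt' : (#(H ∩ inside s t A) : ℤ) < m * (#A - 1) := by exact_mod_cast hlt
    have : (#(K ∩ inside s t A) : ℤ) ≤ m * (#A - 1) := by omega
    exact_mod_cast this

lemma exists_maximal_sparse (m : ℕ) (S : Finset E) :
    ∃ H ⊆ S, IsSparse s t m (ind H) ∧
      ∀ e ∈ S, e ∉ H → ∃ A, IsTight s t m (ind H) A ∧ e ∈ inside s t A := by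
  classical
  obtain ⟨H, -, hH⟩ := (S.powerset.filter fun H => IsSparse s t m (ind H)).exists_le_maximal
    (a := ∅) (by
      simp only [mem_filter, empty_mem_powerset, true_and]
      exact (isSparse_zero m).mono fun e => by simp [ind])
  have h1 := hH.1
  simp only [mem_filter, mem_powerset] at h1
  refine ⟨H, h1.1, h1.2, fun e he heH => ?_⟩
  by_contra! hcon
  refine heH ?_
  rw [hH.eq_of_le (y := insert e H) ?_ (subset_insert _ _)]
  · exact mem_insert_self _ _
  simp only [mem_filter, mem_powerset]
  exact ⟨insert_subset he h1.1, isSparse_exchange h1.2 _ subset_rfl fun A hA hA' =>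
    absurd hA' (hcon A hA)⟩

/-- An inclusion-maximal sparse edge set is already a base: every missing edge is blocked by a tight
set, so its size is at least the total of `z`. -/
lemma exists_isFracBase_ind [Fintype V] {m : ℕ} {z : E → ℝ} (hz : IsFracBase s t m z) :
    ∃ H : Finset E, IsFracBase s t m (ind H) := by
  obtain ⟨H, -, hs, hm⟩ := exists_maximal_sparse (s := s) (t := t) m univ
  refine ⟨H, ind_nonneg H, ind_le_one H, hs, hz.tight.1, le_antisymm (hs _ hz.tight.1) ?_⟩
  rw [← hz.tight.2]
  refine sum_inside_le hz.le_one hz.sparse hs _ fun e _ he => ?_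
  obtain ⟨A, hA, hA'⟩ := hm e (mem_univ e) he
  exact ⟨A, subset_univ _, hA, hA'⟩

end EdgeSparse

/-! ### Exchanging edges to reduce degrees. -/

namespace EdgeSparse

open Finset

variable {V E : Type*} [Fintype E] [DecidableEq V] [DecidableEq E] {s t : E → V}

/-- The degree of `v` in the edge set `H`. -/
def degree (s t : E → V) (H : Finset E) (v : V) : ℤ := #(H ∩ star s t v)

lemma degree_congr {H K : Finset E} {v : V} (h : ∀ e ∈ star s t v, e ∈ H ↔ e ∈ K) :
    degree s t H v = degree s t K v := by
  have : H ∩ star s t v = K ∩ star s t v := by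
    ext e
    simp only [mem_inter]
    exact ⟨fun he => ⟨(h e he.2).1 he.1, he.2⟩, fun he => ⟨(h e he.2).2 he.1, he.2⟩⟩
  rw [degree, this, degree]

/-- Inside a tight set a base can be replaced by another base tight there, independently of the
rest. At a set `B` meeting `A`, sparsity of `y` at `A ∩ B` and of `x` at `A ∪ B` combine through
tightness of `x` at `A`. -/
lemma IsTight.isFracBase_ite [Fintype V] {m : ℕ} {x y : E → ℝ} {A : Finset V}
    (hx : IsFracBase s t m x) (hxA : IsTight s t m x A) (hy : IsFracBase s t m y)
    (hyA : IsTight s t m y A) :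
    IsFracBase s t m (fun e => if e ∈ inside s t A then y e else x e) ∧
      ∀ B, A ⊆ B → ∑ e ∈ inside s t B, (if e ∈ inside s t A then y e else x e)
        = ∑ e ∈ inside s t B, x e := by
  have key : ∀ B, ∑ e ∈ inside s t B, (if e ∈ inside s t A then y e else x e)
      = ∑ e ∈ inside s t (A ∩ B), y e + ∑ e ∈ inside s t B \ inside s t A, x e := by
    intro B
    rw [sum_ite, filter_mem_eq_inter, ← sdiff_eq_filter, inter_comm, inside_inter]
  have heq : ∀ B, A ⊆ B → ∑ e ∈ inside s t B, (if e ∈ inside s t A then y e else x e)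
        = ∑ e ∈ inside s t B, x e := by
    intro B hB
    rw [key, inter_eq_left.2 hB, hyA.2, ← hxA.2, add_comm, sum_sdiff (inside_mono hB)]
  refine ⟨⟨fun e => ?_, fun e => ?_, fun B hB => ?_, hx.tight.1, ?_⟩, heq⟩
  · split_ifs
    exacts [hy.nonneg e, hx.nonneg e]
  · split_ifs
    exacts [hy.le_one e, hx.le_one e]
  · rw [key]
    rcases (A ∩ B).eq_empty_or_nonempty with h | h
    · rw [h]
      have h1 : inside s t (∅ : Finset V) = ∅ := by ext; simp
      rw [h1, sum_empty, zero_add]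
      exact (sum_le_sum_of_subset_of_nonneg sdiff_subset fun e _ _ => hx.nonneg e).trans
        (hx.sparse B hB)
    · have h1 := hy.sparse _ h
      have h2 : ∑ e ∈ inside s t B \ inside s t A, x e
          ≤ ∑ e ∈ inside s t (A ∪ B) \ inside s t A, x e :=
        sum_le_sum_of_subset_of_nonneg
          (sdiff_subset_sdiff (inside_mono subset_union_right) subset_rfl)
          fun e _ _ => hx.nonneg e
      have h3 := sum_sdiff (inside_mono (s := s) (t := t) (subset_union_left (s₁ := A) (s₂ := B)))
        (f := x)
      have h4 := hx.sparse (A ∪ B) (hxA.1.mono subset_union_left)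
      have h5 := hxA.2
      have hc : (#(A ∪ B) : ℝ) + #(A ∩ B) = #A + #B := by
        exact_mod_cast card_union_add_card_inter A B
      have hc' : (m : ℝ) * (#(A ∪ B) - 1) + m * (#(A ∩ B) - 1) = m * (#A - 1) + m * (#B - 1) := by
        linear_combination (m : ℝ) * hc
      linarith
  · rw [heq _ (subset_univ A)]
    exact hx.tight.2

lemma IsTight.of_agree [Fintype V] {m : ℕ} {x y : E → ℝ} {A : Finset V}
    (hx : IsFracBase s t m x) (hy : IsFracBase s t m y) (hA : IsTight s t m x A)
    (h : ∀ e ∉ inside s t A, y e = x e) : IsTight s t m y A := by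
  refine ⟨hA.1, ?_⟩
  have h1 := hx.tight.2
  have h2 := hy.tight.2
  rw [inside_univ, ← sum_sdiff (subset_univ (inside s t A))] at h1 h2
  rw [sum_congr rfl fun e he => h e (mem_sdiff.1 he).2] at h2
  have := hA.2
  linarith

lemma isTight_singleton {m : ℕ} {x : E → ℝ} (hx : ∀ e, 0 ≤ x e) (hs : IsSparse s t m x) (v : V) :
    IsTight s t m x {v} := by
  refine ⟨singleton_nonempty v, le_antisymm (hs _ (singleton_nonempty v)) ?_⟩
  simpa using sum_nonneg fun e _ => hx e

/-- Tight sets around `e` intersect at its ends, so uncrossing closes them under intersection. For a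
missing edge the least one locates the edges it may replace. -/
lemma exists_least_tight [Fintype V] {m : ℕ} {x : E → ℝ} (hx : IsFracBase s t m x) (e : E) :
    ∃ T, IsTight s t m x T ∧ e ∈ inside s t T ∧
      ∀ B, IsTight s t m x B → e ∈ inside s t B → T ⊆ B := by
  classical
  obtain ⟨T, hT, hmin⟩ := exists_min_image
    (univ.filter fun T => IsTight s t m x T ∧ e ∈ inside s t T) card
    ⟨univ, by simpa using hx.tight⟩
  rw [mem_filter] at hT
  refine ⟨T, hT.2.1, hT.2.2, fun B hB he => ?_⟩
  have heI : e ∈ inside s t (T ∩ B) := by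
    rw [← inside_inter]; exact mem_inter.2 ⟨hT.2.2, he⟩
  have h1 := (hT.2.1.uncross hx.nonneg hx.sparse hB ⟨s e, (mem_inside.1 heI).1⟩).2.1
  have h2 := hmin (T ∩ B) (mem_filter.2 ⟨mem_univ _, h1, heI⟩)
  exact inter_eq_left.1 (eq_of_subset_of_card_le inter_subset_left h2)

/-- In a tight set with at least two vertices, every vertex meets an edge. -/
lemma IsTight.exists_mem_star {m : ℕ} (hm : 0 < m) {H : Finset E} (hs : IsSparse s t m (ind H))
    {T : Finset V} (hT : IsTight s t m (ind H) T) {v w : V} (hv : v ∈ T) (hw : w ∈ T)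
    (hvw : w ≠ v) : ∃ f ∈ inside s t T, f ∈ H ∧ f ∈ star s t v := by
  by_contra! hcon
  have h1 := hs (T.erase v) ⟨w, mem_erase.2 ⟨hvw, hw⟩⟩
  have h2 : ∑ e ∈ inside s t (T.erase v), ind H e = ∑ e ∈ inside s t T, ind H e := by
    refine sum_subset (inside_mono (erase_subset v T)) fun e he he' => ?_
    rw [ind, if_neg]
    intro heH
    have h3 := hcon e he heH
    simp only [mem_inside, mem_star, mem_erase] at *
    tauto
  rw [h2, hT.2, cast_card_erase_of_mem hv] at h1
  have : (0 : ℝ) < m := by exact_mod_cast hm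
  nlinarith

lemma degree_swap {H : Finset E} {e f : E} (he : e ∉ H) (hf : f ∈ H) (v : V) :
    degree s t ((insert e H).erase f) v = degree s t H v + (if e ∈ star s t v then 1 else 0)
      - (if f ∈ star s t v then 1 else 0) := by
  have hfe : f ≠ e := fun h => he (h ▸ hf)
  have h1 : ∀ K : Finset E, (#(K ∩ star s t v) : ℤ) = ∑ g ∈ K, if g ∈ star s t v then 1 else 0 := by
    intro K
    rw [← filter_mem_eq_inter, card_filter]
    push_cast
    rfl
  rw [degree, degree, h1, h1, ← sum_insert (f := fun g => if g ∈ star s t v then (1 : ℤ) else 0) he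
    |>.trans (add_comm _ _), ← sum_erase_add _ _ (mem_insert_of_mem hf)]
  ring

/-- Every tight set that gains `e` also loses `f`, so no sparsity constraint breaks. -/
lemma IsFracBase.swap [Fintype V] {m : ℕ} {H : Finset E} (hH : IsFracBase s t m (ind H)) {e f : E}
    (he : e ∉ H) (hf : f ∈ H)
    (h : ∀ A, IsTight s t m (ind H) A → e ∈ inside s t A → f ∈ inside s t A) :
    IsFracBase s t m (ind ((insert e H).erase f)) := by
  refine ⟨ind_nonneg _, ind_le_one _, isSparse_exchange hH.sparse _ (erase_subset _ _)
    fun A hA heA => ⟨f, h A hA heA, hf, notMem_erase _ _⟩, hH.tight.1, ?_⟩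
  rw [← hH.tight.2]
  simp only [inside_univ, sum_ind, inter_univ]
  rw [card_erase_of_mem (mem_insert_of_mem hf), card_insert_of_notMem he, Nat.add_sub_cancel]

/-- The tight set `A` allows a change of the base `H` inside `A` after which all degrees in `A`
are at most `h` and the degree of `v` is less than `h v`. -/
def IsReducible [Fintype V] (s t : E → V) (m : ℕ) (h : V → ℤ) (H : Finset E) (A : Finset V)
    (v : V) : Prop :=
  v ∈ A ∧ IsTight s t m (ind H) A ∧ (∀ w ∈ A, degree s t H w ≤ h w) ∧
    ∃ K : Finset E, IsFracBase s t m (ind K) ∧ (∀ e ∉ inside s t A, e ∈ K ↔ e ∈ H) ∧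
      (∀ w ∈ A, degree s t K w ≤ h w) ∧ degree s t K v < h v

/-- Reductions in `A₁` and `A₂` free one unit of degree at each end of `e`. Adding `e` then costs
nothing, and an edge at any chosen further vertex `v` of the resulting tight set can be deleted in
exchange. -/
lemma IsReducible.exists_swap [Fintype V] {m : ℕ} (hm : 0 < m) {h : V → ℤ} {H : Finset E}
    (hH : IsFracBase s t m (ind H)) {e : E} (he : e ∉ H) {A₁ A₂ : Finset V}
    (h₁ : IsReducible s t m h H A₁ (s e)) (h₂ : IsReducible s t m h H A₂ (t e))
    (hA : Disjoint A₁ A₂) :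
    ∃ T, A₁ ∪ A₂ ⊆ T ∧ IsTight s t m (ind H) T ∧ ∀ v ∈ T, v ∉ A₁ ∪ A₂ →
      ∃ K : Finset E, IsFracBase s t m (ind K) ∧ (∀ g ∉ inside s t T, g ∈ K ↔ g ∈ H) ∧
        (∀ w ∈ A₁ ∪ A₂, degree s t K w ≤ h w) ∧
        (∀ w ∉ A₁ ∪ A₂, degree s t K w ≤ degree s t H w) ∧
        degree s t K v < degree s t H v := by
  obtain ⟨hs, hA₁, -, K₁, hK₁, hoff₁, hd₁, hlt₁⟩ := h₁
  obtain ⟨ht, hA₂, -, K₂, hK₂, hoff₂, hd₂, hlt₂⟩ := h₂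
  have hdis : ∀ {f}, f ∈ inside s t A₁ → f ∉ inside s t A₂ := fun h1 h2 =>
    disjoint_left.1 hA (mem_inside.1 h1).1 (mem_inside.1 h2).1
  have hi : ∀ {K L : Finset E} {f : E}, (f ∈ K ↔ f ∈ L) → ind K f = ind L f := by
    intro K L f hf
    simp only [ind, hf]
  have hT₁ : IsTight s t m (ind K₁) A₁ := hA₁.of_agree hH hK₁ fun f hf => hi (hoff₁ f hf)
  have hT₂ : IsTight s t m (ind K₂) A₂ := hA₂.of_agree hH hK₂ fun f hf => hi (hoff₂ f hf)
  have hT₁₂ : IsTight s t m (ind K₁) A₂ := ⟨hA₂.1, by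
    rw [← hA₂.2]
    exact sum_congr rfl fun f hf => hi (hoff₁ f fun h => hdis h hf)⟩
  -- Disjointness of `A₁` and `A₂` allows both reductions at once.
  set L : Finset E := univ.filter fun f => if f ∈ inside s t A₂ then f ∈ K₂ else f ∈ K₁ with hL
  have memL₁ : ∀ {f}, f ∉ inside s t A₂ → (f ∈ L ↔ f ∈ K₁) := fun {f} hf => by
    simp only [hL, mem_filter, mem_univ, true_and, if_neg hf]
  have memL₂ : ∀ {f}, f ∉ inside s t A₁ → (f ∈ L ↔ f ∈ K₂) := fun {f} hf => by
    by_cases h2 : f ∈ inside s t A₂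
    · simp only [hL, mem_filter, mem_univ, true_and, if_pos h2]
    · rw [memL₁ h2, hoff₁ f hf, hoff₂ f h2]
  have memL : ∀ {f}, f ∉ inside s t A₁ → f ∉ inside s t A₂ → (f ∈ L ↔ f ∈ H) := fun {f} hf hf' => by
    rw [memL₂ hf, hoff₂ f hf']
  have hglue := hT₁₂.isFracBase_ite hK₁ hK₂ hT₂
  have hglue₁ := hA₁.isFracBase_ite hH hK₁ hT₁
  have hindL : (fun f => if f ∈ inside s t A₂ then ind K₂ f else ind K₁ f) = ind L := by
    funext f
    split_ifs with h
    · exact hi (memL₂ fun h1 => hdis h1 h).symm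
    · exact hi (memL₁ h).symm
  have hindK : (fun f => if f ∈ inside s t A₁ then ind K₁ f else ind H f) = ind K₁ := by
    funext f
    split_ifs with h
    · rfl
    · exact hi (hoff₁ f h).symm
  rw [hindL] at hglue
  rw [hindK] at hglue₁
  obtain ⟨hLb, hLs⟩ := hglue
  have hLA₁ : IsTight s t m (ind L) A₁ := ⟨hA₁.1, by
    rw [← hT₁.2]; exact sum_congr rfl fun f hf => hi (memL₁ (hdis hf))⟩
  have hLA₂ : IsTight s t m (ind L) A₂ := ⟨hA₂.1, by
    rw [← hT₂.2]; exact sum_congr rfl fun f hf => hi (memL₂ fun h1 => hdis h1 hf)⟩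
  have he₁ : e ∉ inside s t A₁ := fun h => disjoint_left.1 hA (mem_inside.1 h).2 ht
  have he₂ : e ∉ inside s t A₂ := fun h => disjoint_left.1 hA hs (mem_inside.1 h).1
  have heL : e ∉ L := fun h => he ((memL he₁ he₂).1 h)
  have hstar : ∀ {A : Finset V} {w f}, w ∉ A → f ∈ star s t w → f ∉ inside s t A := by
    intro A w f hw hf hfA
    rw [mem_inside] at hfA
    rcases mem_star.1 hf with rfl | rfl
    exacts [hw hfA.1, hw hfA.2]
  have hdeg₁ : ∀ w ∈ A₁, degree s t L w = degree s t K₁ w := fun w hw =>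
    degree_congr fun f hf => memL₁ (hstar (disjoint_left.1 hA hw) hf)
  have hdeg₂ : ∀ w ∈ A₂, degree s t L w = degree s t K₂ w := fun w hw =>
    degree_congr fun f hf => memL₂ (hstar (disjoint_right.1 hA hw) hf)
  have hdeg : ∀ w ∉ A₁ ∪ A₂, degree s t L w = degree s t H w := fun w hw =>
    degree_congr fun f hf => memL (hstar (fun h => hw (mem_union_left _ h)) hf)
      (hstar (fun h => hw (mem_union_right _ h)) hf)
  obtain ⟨T, hT, heT, hleast⟩ := exists_least_tight hLb e
  have hsT := (mem_inside.1 heT).1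
  have htT := (mem_inside.1 heT).2
  have hT' : IsTight s t m (ind L) (T ∪ A₁ ∪ A₂) := by
    refine ((hT.uncross hLb.nonneg hLb.sparse hLA₁ ⟨s e, ?_⟩).1.uncross hLb.nonneg hLb.sparse
      hLA₂ ⟨t e, ?_⟩).1
    · exact mem_inter.2 ⟨hsT, hs⟩
    · exact mem_inter.2 ⟨mem_union_left _ htT, ht⟩
  refine ⟨T ∪ A₁ ∪ A₂, ?_, ⟨hT'.1, ?_⟩, fun v hv hvA => ?_⟩
  · intro w hw
    simp only [mem_union] at *
    tauto
  · rw [← hT'.2, hLs _ subset_union_right,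
      hglue₁.2 _ (subset_union_right.trans subset_union_left)]
  have hvT : v ∈ T := by
    simp only [mem_union] at hv hvA
    tauto
  -- Any edge of `L` inside the least tight set `T` around `e` may be exchanged for `e`; one meeting
  -- `v` is chosen.
  obtain ⟨f, hfT, hfL, hfv⟩ := hT.exists_mem_star hm hLb.sparse hvT hsT (fun h =>
    hvA (mem_union_left _ (h ▸ hs)))
  have hds : ∀ w, degree s t ((insert e L).erase f) w = degree s t L w
      + (if e ∈ star s t w then 1 else 0) - (if f ∈ star s t w then 1 else 0) :=
    degree_swap heL hfL
  refine ⟨(insert e L).erase f, hLb.swap heL hfL fun A hA heA => inside_mono (hleast A hA heA) hfT,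
    fun g hg => ?_, fun w hw => ?_, fun w hw => ?_, ?_⟩
  · have hgT : g ∉ inside s t T := fun h =>
      hg (inside_mono (subset_union_left.trans subset_union_left) h)
    have hg₁ : g ∉ inside s t A₁ := fun h =>
      hg (inside_mono (subset_union_right.trans subset_union_left) h)
    have hg₂ : g ∉ inside s t A₂ := fun h => hg (inside_mono subset_union_right h)
    have hge : g ≠ e := fun h => hgT (h ▸ heT)
    have hgf : g ≠ f := fun h => hgT (h ▸ hfT)
    rw [mem_erase, mem_insert, memL hg₁ hg₂]
    tauto
  · rw [hds]
    have hfn : (0 : ℤ) ≤ if f ∈ star s t w then 1 else 0 := by split_ifs <;> simp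
    by_cases hew : e ∈ star s t w
    · rw [if_pos hew]
      rcases mem_star.1 hew with rfl | rfl
      · rw [hdeg₁ _ hs]; omega
      · rw [hdeg₂ _ ht]; omega
    · rw [if_neg hew]
      rcases mem_union.1 hw with h | h
      · have := hd₁ w h
        rw [hdeg₁ _ h]; omega
      · have := hd₂ w h
        rw [hdeg₂ _ h]; omega
  · have hew : e ∉ star s t w := fun h => by
      rcases mem_star.1 h with rfl | rfl
      exacts [hw (mem_union_left _ hs), hw (mem_union_right _ ht)]
    have hfn : (0 : ℤ) ≤ if f ∈ star s t w then 1 else 0 := by split_ifs <;> simp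
    rw [hds, if_neg hew, hdeg w hw]
    omega
  · have hew : e ∉ star s t v := fun h => by
      rcases mem_star.1 h with rfl | rfl
      exacts [hvA (mem_union_left _ hs), hvA (mem_union_right _ ht)]
    rw [hds, if_neg hew, if_pos hfv, hdeg v hvA]
    omega

/-- Either some base satisfies all degree bounds, or some base has a set `S` of vertices of full
degree, one of them overfull, whose removal leaves a base of the remaining graph. -/
theorem exists_base_degree_le_or [Fintype V] {m : ℕ} (hm : 0 < m) {z : E → ℝ}
    (hz : IsFracBase s t m z) (h : V → ℤ) :
    (∃ H : Finset E, IsFracBase s t m (ind H) ∧ ∀ v, degree s t H v ≤ h v) ∨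
    ∃ (H : Finset E) (S : Finset V), IsFracBase s t m (ind H) ∧ (∀ v ∈ S, h v ≤ degree s t H v) ∧
      (∃ v ∈ S, h v < degree s t H v) ∧
      ∑ e ∈ inside s t Sᶜ, z e ≤ ∑ e ∈ inside s t Sᶜ, ind H e := by
  classical
  -- The base minimises the total excess over the bounds.
  obtain ⟨H, hH, hmin⟩ := exists_min_image
    (univ.filter fun H : Finset E => IsFracBase s t m (ind H))
    (fun H => ∑ v, (degree s t H v - h v).toNat) (by
      obtain ⟨H, hH⟩ := exists_isFracBase_ind hz
      exact ⟨H, by simpa using hH⟩)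
  simp only [mem_filter, mem_univ, true_and] at hH hmin
  by_cases hgood : ∀ v, degree s t H v ≤ h v
  · exact .inl ⟨H, hH, hgood⟩
  push Not at hgood
  obtain ⟨v₀, hv₀⟩ := hgood
  -- `U` is a maximal set whose vertices can each be brought below their bound by changes inside a
  -- tight subset of `U`; its complement is the required `S`.
  obtain ⟨U, -, hU⟩ := (univ.filter fun U : Finset V =>
    ∀ v ∈ U, ∃ A ⊆ U, IsReducible s t m h H A v).exists_le_maximal (a := ∅) (by simp)
  have hUr : ∀ v ∈ U, ∃ A ⊆ U, IsReducible s t m h H A v := by simpa using hU.1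
  have hUmax : ∀ W : Finset V, U ⊆ W →
      (∀ v ∈ W, v ∉ U → ∃ A ⊆ W, IsReducible s t m h H A v) → W ⊆ U := by
    intro W hUW hW
    refine (hU.eq_of_le (y := W) ?_ hUW).symm.subset
    simp only [mem_filter, mem_univ, true_and]
    intro v hv
    by_cases hvU : v ∈ U
    · obtain ⟨A, hA, hr⟩ := hUr v hvU
      exact ⟨A, hA.trans hUW, hr⟩
    · exact hW v hv hvU
  have hUd : ∀ v ∈ U, degree s t H v ≤ h v := fun v hv => by
    obtain ⟨A, -, hA⟩ := hUr v hv
    exact hA.2.2.1 v hA.1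
  refine .inr ⟨H, Uᶜ, hH, fun v hv => ?_, ⟨v₀, ?_, hv₀⟩, ?_⟩
  · by_contra! hlt
    rw [mem_compl] at hv
    refine hv (hUmax (insert v U) (subset_insert _ _) (fun w hw hwU => ?_) (mem_insert_self _ _))
    obtain rfl : w = v := (mem_insert.1 hw).resolve_right hwU
    have hle : ∀ x ∈ ({w} : Finset V), degree s t H x ≤ h x := fun x hx => by
      rw [mem_singleton.1 hx]; exact hlt.le
    -- A vertex with slack is reducible in its singleton with no change of base, so it could be
    -- added to `U`.
    exact ⟨{w}, by simp, by simp, isTight_singleton hH.nonneg hH.sparse w, hle, H, hH,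
      fun _ _ => Iff.rfl, hle, hlt⟩
  · rw [mem_compl]
    exact fun hv => (hUd v₀ hv).not_gt hv₀
  rw [compl_compl]
  refine sum_inside_le hz.le_one hz.sparse hH.sparse U fun e heU heH => ?_
  obtain ⟨A₁, hA₁U, h₁⟩ := hUr _ (mem_inside.1 heU).1
  obtain ⟨A₂, hA₂U, h₂⟩ := hUr _ (mem_inside.1 heU).2
  by_cases hdis : Disjoint A₁ A₂
  swap
  · refine ⟨A₁ ∪ A₂, union_subset hA₁U hA₂U, (h₁.2.1.uncross hH.nonneg hH.sparse h₂.2.1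
      (not_disjoint_iff_nonempty_inter.1 hdis)).1, ?_⟩
    rw [mem_inside]
    exact ⟨mem_union_left _ h₁.1, mem_union_right _ h₂.1⟩
  obtain ⟨T, hAT, hT, hswap⟩ := h₁.exists_swap hm hH heH h₂ hdis
  have hAU := union_subset hA₁U hA₂U
  by_contra! hno
  have hTU : ¬ T ⊆ U := fun hTU => hno T hTU hT
    (mem_inside.2 ⟨hAT (mem_union_left _ h₁.1), hAT (mem_union_right _ h₂.1)⟩)
  -- If `T` has an overfull vertex, a swap there lowers the total excess. Otherwise every vertex of
  -- `T` outside `U` becomes reducible in `T`, and `U ∪ T` contradicts maximality of `U`.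
  by_cases hex : ∃ v ∈ T, h v < degree s t H v
  · obtain ⟨v, hvT, hv⟩ := hex
    have hvA : v ∉ A₁ ∪ A₂ := fun h => (hUd v (hAU h)).not_gt hv
    obtain ⟨K, hK, -, hd, hd', hlt⟩ := hswap v hvT hvA
    refine (hmin K hK).not_gt (sum_lt_sum (fun w _ => ?_) ⟨v, mem_univ v, ?_⟩)
    · by_cases hw : w ∈ A₁ ∪ A₂
      · have := hd w hw
        omega
      · have := hd' w hw
        omega
    · omega
  · push Not at hex
    refine hTU (subset_union_right.trans (hUmax (U ∪ T) subset_union_left fun v hv hvU => ?_))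
    have hvT := (mem_union.1 hv).resolve_left hvU
    obtain ⟨K, hK, hoff, hd, hd', hlt⟩ := hswap v hvT fun h => hvU (hAU h)
    refine ⟨T, subset_union_right, hvT, hT, hex, K, hK, hoff, fun w hw => ?_,
      hlt.trans_le (hex v hvT)⟩
    by_cases hwA : w ∈ A₁ ∪ A₂
    · exact hd w hwA
    · exact (hd' w hwA).trans (hex w hw)

end EdgeSparse

/-! ### Rigid extreme points and the two-partition argument. -/

namespace EdgeSparse

open Finset

/-- A linear program in a box has an optimal solution that admits no perturbation preserving the
tight constraints. -/
lemma exists_rigid_solution {E ι : Type*} [Fintype E] [Finite ι] (u : E → ℝ) (a : ι → E → ℝ)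
    (b : ι → ℝ) (c : E → ℝ) {z : E → ℝ} (hz0 : ∀ e, 0 ≤ z e) (hzu : ∀ e, z e ≤ u e)
    (hz : ∀ i, ∑ e, a i e * z e ≤ b i) :
    ∃ x : E → ℝ, (∀ e, 0 ≤ x e) ∧ (∀ e, x e ≤ u e) ∧ (∀ i, ∑ e, a i e * x e ≤ b i) ∧
      ∑ e, c e * x e ≤ ∑ e, c e * z e ∧
      ∀ y : E → ℝ, (∀ e, x e = 0 ∨ x e = u e → y e = 0) →
        (∀ i, ∑ e, a i e * x e = b i → ∑ e, a i e * y e = 0) → y = 0 := by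
  set Q : Set (E → ℝ) := Set.Icc 0 u ∩ {x | ∀ i, ∑ e, a i e * x e ≤ b i} with hQ
  have hcont : ∀ a : E → ℝ, Continuous fun x : E → ℝ => ∑ e, a e * x e := fun a => by fun_prop
  have hQc : IsCompact Q := by
    refine isCompact_Icc.inter_right ?_
    simp only [Set.ofPred_forall]
    exact isClosed_iInter fun i => isClosed_le (hcont _) continuous_const
  have hzQ : z ∈ Q := ⟨⟨hz0, hzu⟩, hz⟩
  obtain ⟨x₀, hx₀, hmin⟩ := hQc.exists_isMinOn ⟨z, hzQ⟩ (hcont c).continuousOn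
  have hfc : IsCompact (Q ∩ {x | ∑ e, c e * x e ≤ ∑ e, c e * x₀ e}) :=
    hQc.inter_right (isClosed_le (hcont _) continuous_const)
  -- An extreme point of the optimal face: a perturbation feasible in both directions keeps the
  -- objective optimal, hence stays in the face and must vanish.
  obtain ⟨x, hx⟩ := hfc.extremePoints_nonempty ⟨x₀, hx₀, le_refl (∑ e, c e * x₀ e)⟩
  rw [mem_extremePoints] at hx
  obtain ⟨⟨hxQ, hxc⟩, hext⟩ := hx
  refine ⟨x, hxQ.1.1, hxQ.1.2, hxQ.2, le_trans hxc (hmin hzQ), fun y hy hyt => ?_⟩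
  have hlin : ∀ (a : E → ℝ) (r : ℝ), ∑ e, a e * (x + r • y) e
      = ∑ e, a e * x e + r * ∑ e, a e * y e := by
    intro a r
    rw [mul_sum, ← sum_add_distrib]
    exact sum_congr rfl fun e _ => by simp; ring
  have hev : ∀ᶠ r : ℝ in nhds 0, x + r • y ∈ Q := by
    have h1 : ∀ᶠ r : ℝ in nhds 0, ∀ e, 0 ≤ x e + r * y e ∧ x e + r * y e ≤ u e := by
      rw [Filter.eventually_all]
      intro e
      have hc : Filter.Tendsto (fun r : ℝ => x e + r * y e) (nhds 0) (nhds (x e)) := by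
        have : Continuous fun r : ℝ => x e + r * y e := by fun_prop
        simpa using this.tendsto 0
      by_cases h : x e = 0 ∨ x e = u e
      · simp only [hy e h, mul_zero, add_zero]
        exact Filter.Eventually.of_forall fun _ => ⟨hxQ.1.1 e, hxQ.1.2 e⟩
      · push Not at h
        filter_upwards [hc.eventually (lt_mem_nhds ((hxQ.1.1 e).lt_of_ne' h.1)),
          hc.eventually (gt_mem_nhds ((hxQ.1.2 e).lt_of_ne h.2))] with r h1 h2
        exact ⟨h1.le, h2.le⟩
    have h2 : ∀ᶠ r : ℝ in nhds 0, ∀ i, ∑ e, a i e * x e + r * ∑ e, a i e * y e ≤ b i := by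
      rw [Filter.eventually_all]
      intro i
      by_cases h : ∑ e, a i e * x e = b i
      · simp only [hyt i h, mul_zero, add_zero]
        exact Filter.Eventually.of_forall fun _ => h.le
      · have hc : Filter.Tendsto (fun r : ℝ => ∑ e, a i e * x e + r * ∑ e, a i e * y e) (nhds 0)
            (nhds (∑ e, a i e * x e)) := by
          have : Continuous fun r : ℝ => ∑ e, a i e * x e + r * ∑ e, a i e * y e := by fun_prop
          simpa using this.tendsto 0
        filter_upwards [hc.eventually (gt_mem_nhds ((hxQ.2 i).lt_of_ne h))] with r h1
        exact h1.le
    filter_upwards [h1, h2] with r h1 h2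
    refine ⟨⟨fun e => ?_, fun e => ?_⟩, fun i => ?_⟩
    · simpa using (h1 e).1
    · simpa using (h1 e).2
    · rw [hlin]; exact h2 i
  obtain ⟨ε, hε, hball⟩ := Metric.eventually_nhds_iff.1 hev
  have hp := hball (y := ε / 2) (by rw [Real.dist_eq, sub_zero, abs_of_pos] <;> linarith)
  have hn := hball (y := -(ε / 2)) (by
    rw [Real.dist_eq, sub_zero, abs_neg, abs_of_pos] <;> linarith)
  have hcp := hmin hp
  have hcn := hmin hn
  simp only [Set.mem_ofPred_eq] at hcp hcn hxc
  rw [hlin] at hcp hcn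
  have heq := (hext (x + (ε / 2) • y) ⟨hp, by simp only [Set.mem_ofPred_eq]; rw [hlin]; linarith⟩
    (x + (-(ε / 2)) • y) ⟨hn, by simp only [Set.mem_ofPred_eq]; rw [hlin]; linarith⟩
    ⟨1 / 2, 1 / 2, by norm_num, by norm_num, by norm_num, by ext e; simp; ring⟩).1
  have : (ε / 2) • y = 0 := by simpa using heq
  exact (smul_eq_zero.1 this).resolve_left (by positivity)

/-- Two partitions of a nonempty finite set, the second possibly of a part of it only, into classes
with at least two elements do not separate functions by their class sums. -/
lemma exists_ne_zero_of_partitions {F C₁ C₂ : Type*} [Fintype F] [Nonempty F] [DecidableEq C₁]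
    [DecidableEq C₂] (p : F → C₁) (q : F → Option C₂)
    (hp : ∀ f, ∃ g, g ≠ f ∧ p g = p f) (hq : ∀ f, q f ≠ none → ∃ g, g ≠ f ∧ q g = q f) :
    ∃ y : F → ℝ, y ≠ 0 ∧ (∀ k, ∑ f with p f = k, y f = 0) ∧
      ∀ k, ∑ f with q f = some k, y f = 0 := by
  classical
  set I₁ := univ.image p with hI₁
  set I₂ := (univ.image q).erase none with hI₂
  let L : (F → ℝ) →ₗ[ℝ] (I₁ ⊕ I₂ → ℝ) :=
    { toFun := fun y => Sum.elim (fun k => ∑ f with p f = k, y f) fun k => ∑ f with q f = k, y f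
      map_add' := fun y z => by
        ext (k | k) <;> simp [sum_add_distrib]
      map_smul' := fun r y => by
        ext (k | k) <;> simp [mul_sum] }
  have hL₁ : ∀ y k, L y (.inl k) = ∑ f with p f = k, y f := fun _ _ => rfl
  have hL₂ : ∀ y k, L y (.inr k) = ∑ f with q f = k, y f := fun _ _ => rfl
  suffices h : ¬ Function.Injective L by
    rw [← LinearMap.ker_eq_bot, Submodule.eq_bot_iff] at h
    push Not at h
    obtain ⟨y, hy, hy0⟩ := h
    rw [LinearMap.mem_ker] at hy
    refine ⟨y, hy0, fun k => ?_, fun k => ?_⟩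
    · by_cases hk : k ∈ I₁
      · rw [← hL₁ y ⟨k, hk⟩, hy]; rfl
      · refine sum_eq_zero fun f hf => absurd (mem_image.2 ⟨f, mem_univ f, ?_⟩) hk
        exact (mem_filter.1 hf).2
    · by_cases hk : some k ∈ I₂
      · rw [← hL₂ y ⟨some k, hk⟩, hy]; rfl
      · refine sum_eq_zero fun f hf => absurd ?_ hk
        rw [hI₂, mem_erase]
        exact ⟨by simp, mem_image.2 ⟨f, mem_univ f, (mem_filter.1 hf).2⟩⟩
  intro hinj
  have hc₁ : #I₁ * 2 ≤ Fintype.card F := by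
    rw [← card_univ, card_eq_sum_card_image p univ, ← smul_eq_mul]
    refine card_nsmul_le_sum _ _ _ fun k hk => ?_
    obtain ⟨f, -, rfl⟩ := mem_image.1 hk
    obtain ⟨g, hg, hgf⟩ := hp f
    exact one_lt_card.2 ⟨g, by simp [hgf], f, by simp, hg⟩
  have hc₂' : #I₂ * 2 ≤ #(univ.filter fun f => q f ≠ none) := by
    rw [card_eq_sum_card_fiberwise (f := q) (t := I₂), ← smul_eq_mul]
    · refine card_nsmul_le_sum _ _ _ fun k hk => ?_
      rw [hI₂, mem_erase] at hk
      obtain ⟨hk0, hk⟩ := hk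
      obtain ⟨f, -, rfl⟩ := mem_image.1 hk
      obtain ⟨g, hg, hgf⟩ := hq f hk0
      exact one_lt_card.2 ⟨g, by simp [hgf, hk0], f, by simp [hk0], hg⟩
    · intro f hf
      rw [mem_coe, mem_filter] at hf
      rw [hI₂, mem_coe, mem_erase]
      exact ⟨hf.2, mem_image_of_mem q (mem_univ f)⟩
  have hc₂ : #(univ.filter fun f => q f ≠ none) ≤ Fintype.card F := card_le_univ _
  have hrank := LinearMap.finrank_le_finrank_of_injective hinj
  simp only [Module.finrank_fintype_fun_eq_card, Fintype.card_sum, Fintype.card_coe] at hrank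
  -- Classes of size at least two give at most `|F|` class sums in all. Injectivity forces equality,
  -- so the second partition covers everything too.
  have hqn : ∀ f, q f ≠ none := by
    have : univ.filter (fun f => q f ≠ none) = univ :=
      eq_univ_of_card _ (by omega)
    intro f
    simpa using this.symm.subset (mem_univ f)
  have hsurj : Function.Surjective L :=
    (LinearMap.injective_iff_surjective_of_finrank_eq_finrank (by
      simp only [Module.finrank_fintype_fun_eq_card, Fintype.card_sum, Fintype.card_coe]
      omega)).1 hinj
  obtain ⟨f₀⟩ := ‹Nonempty F›
  -- With both partitions covering `F`, the two families of class sums have the same total, so this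
  -- target vector is unattainable.
  obtain ⟨y, hy⟩ := hsurj (Pi.single (.inl ⟨p f₀, mem_image_of_mem p (mem_univ f₀)⟩) 1)
  have h₁ : ∑ k : I₁, L y (.inl k) = ∑ f, y f := by
    simp only [hL₁]
    rw [sum_coe_sort I₁ fun k => ∑ f with p f = k, y f]
    exact sum_fiberwise_of_maps_to (fun f _ => mem_image_of_mem p (mem_univ f)) y
  have h₂ : ∑ k : I₂, L y (.inr k) = ∑ f, y f := by
    simp only [hL₂]
    rw [sum_coe_sort I₂ fun k => ∑ f with q f = k, y f]
    refine sum_fiberwise_of_maps_to (fun f _ => ?_) y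
    rw [hI₂, mem_erase]
    exact ⟨hqn f, mem_image_of_mem q (mem_univ f)⟩
  have h₃ : ∑ k : I₂, L y (.inr k) = 0 := sum_eq_zero fun k _ => by rw [hy]; simp
  have h₄ : ∑ k : I₁, L y (.inl k) = 1 := by
    rw [hy, sum_eq_single ⟨p f₀, mem_image_of_mem p (mem_univ f₀)⟩]
    · simp
    · intro k _ hk
      rw [Pi.single_apply, if_neg (by simpa using hk)]
    · simp
  linarith

variable {V E : Type*} [Fintype E] [DecidableEq V] [DecidableEq E] {s t : E → V}

/-- The edges are partitioned by the least tight sets containing them; every class with a fractional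
edge has another one, and tight sets consist of whole classes. -/
lemma IsFracBase.exists_partition [Fintype V] {m : ℕ} {x : E → ℝ} (hx : IsFracBase s t m x) :
    ∃ p : E → Finset V,
      (∀ e, x e ≠ 0 → x e ≠ 1 → ∃ f, f ≠ e ∧ x f ≠ 0 ∧ x f ≠ 1 ∧ p f = p e) ∧
      ∀ y : E → ℝ, (∀ k, ∑ e with p e = k, y e = 0) →
        ∀ A, IsTight s t m x A → ∑ e ∈ inside s t A, y e = 0 := by
  classical
  choose T hT heT hleast using exists_least_tight hx
  refine ⟨T, fun e h0 h1 => ?_, fun y hy A hA => ?_⟩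
  · by_contra! hcon
    have hpos : 0 < x e := (hx.nonneg e).lt_of_ne' h0
    -- The tight subsets of `T e` not containing `e` are closed under unions of intersecting members
    -- because `x e > 0`. They cover an edge set of integral weight.
    obtain ⟨𝓜, hM, hsum⟩ := exists_sum_covered (s := s) (t := t)
      (fun B => IsTight s t m x B ∧ B ⊆ T e ∧ e ∉ inside s t B) (by
        rintro A B ⟨hA, hAT, heA⟩ ⟨hB, hBT, heB⟩ hAB
        obtain ⟨h1, -, h2⟩ := hA.uncross hx.nonneg hx.sparse hB hAB
        exact ⟨h1, union_subset hAT hBT, fun h => (h2 e h hpos).elim heA heB⟩)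
    set C := univ.filter fun f =>
      ∃ B, (IsTight s t m x B ∧ B ⊆ T e ∧ e ∉ inside s t B) ∧ f ∈ inside s t B with hC
    specialize hsum C (by simp [hC]) x
    have hCT : C ⊆ (inside s t (T e)).erase e := by
      intro f hf
      simp only [hC, mem_filter, mem_univ, true_and] at hf
      obtain ⟨B, ⟨-, hB, heB⟩, hf⟩ := hf
      exact mem_erase.2 ⟨fun h => heB (h ▸ hf), inside_mono hB hf⟩
    set Z : AddSubgroup ℝ := (Int.castAddHom ℝ).range with hZ
    have hint : ∀ n : ℤ, (n : ℝ) ∈ Z := fun n => ⟨n, rfl⟩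
    have htight : ∀ B, IsTight s t m x B → ∑ f ∈ inside s t B, x f ∈ Z := by
      intro B hB
      rw [hB.2]
      simpa using hint (m * (#B - 1))
    have hCZ : ∑ f ∈ C, x f ∈ Z := by
      rw [hsum]
      exact sum_mem fun B hB => htight B (hM B hB).1
    -- An uncovered edge `f` has `T f = T e`, so it is integral by the assumption that `e` is the
    -- only fractional edge of its class. Hence `x e` would be an integer.
    have hrest : ∑ f ∈ (inside s t (T e)).erase e \ C, x f ∈ Z := by
      refine sum_mem fun f hf => ?_
      rw [mem_sdiff, mem_erase] at hf
      by_cases hf0 : x f = 0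
      · simp [hf0]
      by_cases hf1 : x f = 1
      · simpa [hf1] using hint 1
      refine absurd ?_ hf.2
      simp only [hC, mem_filter, mem_univ, true_and]
      have hle := hleast f _ (hT e) hf.1.2
      refine ⟨T f, ⟨hT f, hle, fun h => hcon f hf.1.1 hf0 hf1 ?_⟩, heT f⟩
      exact hle.antisymm (hleast e _ (hT f) h)
    have hall := htight _ (hT e)
    rw [← add_sum_erase _ _ (heT e), ← sum_sdiff hCT] at hall
    have hxe : x e ∈ Z := (add_mem_cancel_right (add_mem hrest hCZ)).1 hall
    obtain ⟨n, hn⟩ := hxe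
    have hlt : x e < 1 := (hx.le_one e).lt_of_ne h1
    rw [← hn] at hpos hlt
    simp only [Int.coe_castAddHom] at hpos hlt
    have h1 : 0 < n := by exact_mod_cast hpos
    have h2 : n < 1 := by exact_mod_cast hlt
    omega
  · have hA' : inside s t A = univ.filter fun e => T e ⊆ A := by
      ext e
      simp only [mem_filter, mem_univ, true_and]
      exact ⟨hleast e A hA, fun h => inside_mono h (heT e)⟩
    rw [hA', ← sum_fiberwise_of_maps_to (g := T) (t := univ.filter (· ⊆ A))
      (fun e he => by simpa using he)]
    refine sum_eq_zero fun k hk => ?_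
    rw [filter_filter]
    rw [← hy k]
    apply sum_congr _ fun _ _ => rfl
    ext e
    simp only [mem_filter, mem_univ, true_and] at hk ⊢
    exact ⟨fun h => h.2, fun h => ⟨h ▸ hk, h⟩⟩

end EdgeSparse

/-! ### Integrality on independent sets and splitting into trees. -/

namespace EdgeSparse

open Finset

variable {V E : Type*} [Fintype E] [DecidableEq V] [DecidableEq E] {s t : E → V}

lemma sum_ind_mul (S : Finset E) (x : E → ℝ) : ∑ e, ind S e * x e = ∑ e ∈ S, x e := by
  simp [ind]

/-- If the rigidity of a point is tested by two partitions whose classes contain no single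
fractional edge, then the point is integral. -/
lemma not_of_rigid {C₁ C₂ : Type*} [DecidableEq C₁] [DecidableEq C₂] (P : E → Prop) (p : E → C₁)
    (q : E → Option C₂) (hp : ∀ e, P e → ∃ f, f ≠ e ∧ P f ∧ p f = p e)
    (hq : ∀ e, P e → q e ≠ none → ∃ f, f ≠ e ∧ P f ∧ q f = q e)
    (hr : ∀ y : E → ℝ, (∀ e, ¬ P e → y e = 0) → (∀ k, ∑ e with p e = k, y e = 0) →
      (∀ k, ∑ e with q e = some k, y e = 0) → y = 0) (e : E) : ¬ P e := by
  classical
  intro he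
  have : Nonempty {e // P e} := ⟨⟨e, he⟩⟩
  obtain ⟨y, hy0, hyp, hyq⟩ := exists_ne_zero_of_partitions (fun f : {e // P e} => p f)
    (fun f : {e // P e} => q f)
    (fun f => by
      obtain ⟨g, hg, hPg, h⟩ := hp f f.2
      exact ⟨⟨g, hPg⟩, fun h => hg (congrArg Subtype.val h), h⟩)
    (fun f hf => by
      obtain ⟨g, hg, hPg, h⟩ := hq f f.2 hf
      exact ⟨⟨g, hPg⟩, fun h => hg (congrArg Subtype.val h), h⟩)
  set Y : E → ℝ := fun e => if h : P e then y ⟨e, h⟩ else 0 with hY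
  have hYs : ∀ f : {e // P e}, Y f = y f := fun f => by simp only [hY, dif_pos f.2]
  have hYn : ∀ e, ¬ P e → Y e = 0 := fun e h => by simp only [hY, dif_neg h]
  have hsum : ∀ (R : E → Prop) [DecidablePred R], ∑ e with R e, Y e = ∑ f : {e // P e}, if R f then y f else 0 := by
    intro R _
    rw [sum_filter, ← sum_filter_of_ne (p := P), ← sum_subtype_eq_sum_filter]
    · simp only [hYs, subtype_univ]
    · intro f _ hf
      by_contra h
      simp [hYn f h] at hf
  refine hy0 (funext fun f => ?_)
  have := hr Y hYn (fun k => by rw [hsum, ← sum_filter]; exact hyp k)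
    (fun k => by rw [hsum, ← sum_filter]; exact hyq k)
  rw [← hYs, this]
  rfl

lemma exists_ne_of_sum_eq_int {x : E → ℝ} (h0 : ∀ e, 0 ≤ x e) (h1 : ∀ e, x e ≤ 1) {S : Finset E}
    {n : ℤ} (hS : ∑ e ∈ S, x e = n) {e : E} (he : e ∈ S) (he0 : x e ≠ 0) (he1 : x e ≠ 1) :
    ∃ f ∈ S, f ≠ e ∧ x f ≠ 0 ∧ x f ≠ 1 := by
  by_contra! hcon
  have hint : ∑ f ∈ S.erase e, x f ∈ (Int.castAddHom ℝ).range := by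
    refine sum_mem fun f hf => ?_
    rw [mem_erase] at hf
    by_cases hf0 : x f = 0
    · exact ⟨0, by simp [hf0]⟩
    · exact ⟨1, by simp [hcon f hf.2 hf.1 hf0]⟩
  obtain ⟨k, hk⟩ := hint
  simp only [Int.coe_castAddHom] at hk
  rw [← add_sum_erase _ _ he, ← hk] at hS
  have h2 : 0 < x e := (h0 e).lt_of_ne' he0
  have h3 : x e < 1 := (h1 e).lt_of_ne he1
  have h4 : (k : ℝ) < n := by linarith
  have h5 : (n : ℝ) < k + 1 := by linarith
  have h4' : k < n := by exact_mod_cast h4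
  have h5' : n < k + 1 := by exact_mod_cast h5
  omega

/-- Integrality of the base polytope with degree bounds on an independent set, for the objective
function "degree of `u`". -/
theorem exists_base_of_independent [Fintype V] {m : ℕ} {X : Finset V}
    (hX : ∀ e, ¬ (s e ∈ X ∧ t e ∈ X)) (h : V → ℤ) {z : E → ℝ} (hz : IsFracBase s t m z)
    (hzX : ∀ v ∈ X, ∑ e ∈ star s t v, z e ≤ h v) (u : V) :
    ∃ H : Finset E, IsFracBase s t m (ind H) ∧ (∀ v ∈ X, degree s t H v ≤ h v) ∧
      (degree s t H u : ℝ) ≤ ∑ e ∈ star s t u, z e := by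
  classical
  obtain ⟨x, hx0, hx1, hxa, hxc, hr⟩ := exists_rigid_solution
    (ι := {A : Finset V // A.Nonempty} ⊕ Unit ⊕ X) (fun _ : E => 1)
    (Sum.elim (fun A => ind (inside s t A)) (Sum.elim (fun _ _ => -1) fun v => ind (star s t v)))
    (Sum.elim (fun A => m * ((#A.1 : ℝ) - 1))
      (Sum.elim (fun _ => -(m * ((#(univ : Finset V) : ℝ) - 1))) fun v => h v))
    (ind (star s t u)) hz.nonneg hz.le_one (by
      rintro (A | _ | v)
      · simpa only [Sum.elim_inl, sum_ind_mul] using hz.sparse A A.2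
      · have := hz.tight.2
        rw [inside_univ] at this
        simp [this]
      · simpa only [Sum.elim_inr, sum_ind_mul] using hzX v v.2)
  rw [sum_ind_mul, sum_ind_mul] at hxc
  have hsp : IsSparse s t m x := fun A hA => by
    simpa only [Sum.elim_inl, sum_ind_mul] using hxa (.inl ⟨A, hA⟩)
  have hstar : ∀ v ∈ X, ∑ e ∈ star s t v, x e ≤ h v := fun v hv => by
    simpa only [Sum.elim_inr, sum_ind_mul] using hxa (.inr (.inr ⟨v, hv⟩))
  have htot : IsTight s t m x univ := by
    refine ⟨hz.tight.1, le_antisymm (hsp _ hz.tight.1) ?_⟩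
    have := hxa (.inr (.inl ()))
    simp only [Sum.elim_inr, Sum.elim_inl, neg_mul, one_mul, sum_neg_distrib, neg_le_neg_iff] at this
    rwa [inside_univ]
  have hxb : IsFracBase s t m x := ⟨hx0, hx1, hsp, htot⟩
  obtain ⟨p, hp, hpt⟩ := hxb.exists_partition
  let good : V → Prop := fun v => v ∈ X ∧ ∑ e ∈ star s t v, x e = h v
  -- Independence of `X` means an edge has at most one end with a tight degree bound, so `q` is well
  -- determined by its fibres, the stars of such ends.
  let q : E → Option V := fun e => if good (s e) then some (s e) else
    if good (t e) then some (t e) else none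
  have hq : ∀ e v, q e = some v ↔ good v ∧ e ∈ star s t v := by
    intro e v
    simp only [q, mem_star]
    by_cases h1 : good (s e)
    · have h2 : ¬ good (t e) := fun h2 => hX e ⟨h1.1, h2.1⟩
      rw [if_pos h1, Option.some_inj]
      constructor
      · rintro rfl
        exact ⟨h1, .inl rfl⟩
      · rintro ⟨hv, rfl | rfl⟩
        exacts [rfl, absurd hv h2]
    · rw [if_neg h1]
      by_cases h2 : good (t e)
      · rw [if_pos h2, Option.some_inj]
        constructor
        · rintro rfl
          exact ⟨h2, .inr rfl⟩
        · rintro ⟨hv, rfl | rfl⟩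
          exacts [absurd hv h1, rfl]
      · rw [if_neg h2]
        simp only [reduceCtorEq, false_iff]
        rintro ⟨hv, rfl | rfl⟩
        exacts [h1 hv, h2 hv]
  have hint := not_of_rigid (fun e => x e ≠ 0 ∧ x e ≠ 1) p q
    (fun e he => by
      obtain ⟨f, h1, h2, h3, h4⟩ := hp e he.1 he.2
      exact ⟨f, h1, ⟨h2, h3⟩, h4⟩)
    (fun e he hqe => by
      obtain ⟨v, hv⟩ := Option.ne_none_iff_exists'.1 hqe
      obtain ⟨hg, hev⟩ := (hq e v).1 hv
      obtain ⟨f, h1, h2, h3, h4⟩ := exists_ne_of_sum_eq_int hx0 hx1 hg.2 hev he.1 he.2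
      exact ⟨f, h2, ⟨h3, h4⟩, by rw [hv, hq]; exact ⟨hg, h1⟩⟩)
    (fun y hy hyp hyq => hr y (fun e he => hy e (by tauto)) (by
      rintro (A | _ | v) ht
      · simp only [Sum.elim_inl, sum_ind_mul] at ht ⊢
        exact hpt y hyp A ⟨A.2, ht⟩
      · have := hpt y hyp univ htot
        rw [inside_univ] at this
        simp [this]
      · simp only [Sum.elim_inr, sum_ind_mul] at ht ⊢
        rw [← hyq v]
        refine sum_congr ?_ fun _ _ => rfl
        ext e
        rw [mem_filter, hq]
        exact ⟨fun he => ⟨mem_univ e, ⟨v.2, ht⟩, he⟩, fun he => he.2.2⟩))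
  have hxH : x = ind (univ.filter fun e => x e = 1) := by
    funext e
    have := hint e
    by_cases h1 : x e = 1
    · simp [ind, h1]
    · have h0 : x e = 0 := by tauto
      simp [ind, h0]
  set H := univ.filter fun e => x e = 1
  rw [hxH] at hxb hstar hxc
  simp only [sum_ind] at hstar hxc
  exact ⟨H, hxb, fun v hv => by exact_mod_cast hstar v hv, by simpa [degree] using hxc⟩

/-- A base of the `(m + 1)`-fold union contains a spanning tree whose complement is a base of the
`m`-fold union. -/
lemma IsFracBase.exists_split [Fintype V] {m : ℕ} {B : Finset E}
    (hB : IsFracBase s t (m + 1) (ind B)) :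
    ∃ H ⊆ B, IsFracBase s t 1 (ind H) ∧ IsFracBase s t m (ind (B \ H)) := by
  classical
  have hm : (0 : ℝ) < m + 1 := by positivity
  have hm' : ((m + 1 : ℕ) : ℝ) = m + 1 := by push_cast; rfl
  -- The program asks that `x` be sparse for one tree and `ind B - x` sparse for `m` trees. The
  -- point `ind B / (m + 1)` is feasible, and the objective is zero because only rigidity matters.
  obtain ⟨x, hx0, hxu, hxa, -, hr⟩ := exists_rigid_solution
    (ι := {A : Finset V // A.Nonempty} ⊕ {A : Finset V // A.Nonempty}) (ind B)
    (Sum.elim (fun A => ind (inside s t A)) fun A e => -ind (inside s t A) e)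
    (Sum.elim (fun A => (#A.1 : ℝ) - 1)
      fun A => m * ((#A.1 : ℝ) - 1) - ∑ e ∈ inside s t A, ind B e)
    0 (z := fun e => ind B e / (m + 1)) (fun e => div_nonneg (ind_nonneg B e) hm.le)
    (fun e => div_le_self (ind_nonneg B e) (by linarith [m.cast_nonneg (α := ℝ)])) (by
      rintro (A | A)
      · have := hB.sparse A A.2
        simp only [Sum.elim_inl, sum_ind_mul, ← sum_div]
        rw [div_le_iff₀ hm]
        rw [hm'] at this
        linarith
      · have := hB.sparse A A.2
        simp only [Sum.elim_inr, neg_mul, sum_neg_distrib, sum_ind_mul, ← sum_div]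
        rw [hm'] at this
        set S := ∑ e ∈ inside s t A, ind B e
        have h1 : S - S / (m + 1) = m * (S / (m + 1)) := by field_simp; ring
        have h2 : S / (m + 1) ≤ (#A.1 : ℝ) - 1 := by rw [div_le_iff₀ hm]; linarith
        have := mul_le_mul_of_nonneg_left h2 m.cast_nonneg
        linarith)
  have hsx : ∀ A : Finset V, A.Nonempty → ∑ e ∈ inside s t A, x e ≤ (#A : ℝ) - 1 := fun A hA => by
    simpa only [Sum.elim_inl, sum_ind_mul] using hxa (.inl ⟨A, hA⟩)
  have hsw : ∀ A : Finset V, A.Nonempty →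
      ∑ e ∈ inside s t A, (ind B e - x e) ≤ m * ((#A : ℝ) - 1) := fun A hA => by
    have := hxa (.inr ⟨A, hA⟩)
    simp only [Sum.elim_inr, neg_mul, sum_neg_distrib, sum_ind_mul] at this
    rw [sum_sub_distrib]
    linarith
  have hU := hB.tight.1
  have htot := hB.tight.2
  rw [hm'] at htot
  have hx1 := hsx univ hU
  have hw1 := hsw univ hU
  rw [sum_sub_distrib] at hw1
  have hxb : IsFracBase s t 1 x := ⟨hx0, fun e => (hxu e).trans (ind_le_one B e),
    fun A hA => by simpa using hsx A hA, hU, by rw [Nat.cast_one]; linarith⟩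
  have hwb : IsFracBase s t m (fun e => ind B e - x e) := ⟨fun e => sub_nonneg.2 (hxu e),
    fun e => by linarith [hx0 e, ind_le_one B e], hsw, hU, by rw [sum_sub_distrib]; linarith⟩
  have hoff : ∀ e ∉ B, x e = 0 := fun e he =>
    le_antisymm ((hxu e).trans_eq (by simp [ind, he])) (hx0 e)
  have hon : ∀ e ∈ B, ind B e = 1 := fun e he => by simp [ind, he]
  obtain ⟨p, hp, hpt⟩ := hxb.exists_partition
  obtain ⟨q, hq, hqt⟩ := hwb.exists_partition
  have hint := not_of_rigid (fun e => e ∈ B ∧ x e ≠ 0 ∧ x e ≠ 1) p (fun e => some (q e))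
    (fun e he => by
      obtain ⟨f, h1, h2, h3, h4⟩ := hp e he.2.1 he.2.2
      exact ⟨f, h1, ⟨by_contra fun h => h2 (hoff f h), h2, h3⟩, h4⟩)
    (fun e he _ => by
      have h1 := hon e he.1
      obtain ⟨f, h2, h3, h4, h5⟩ := hq e (fun h => he.2.2 (by linarith))
        (fun h => he.2.1 (by linarith))
      have hfB : f ∈ B := by
        by_contra h
        exact h3 (by rw [hoff f h]; simp [ind, h])
      rw [hon f hfB] at h3 h4
      exact ⟨f, h2, ⟨hfB, fun h => h4 (by linarith), fun h => h3 (by linarith)⟩, by rw [h5]⟩)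
    (fun y hy hyp hyq => hr y (fun e he => hy e (by
        rintro ⟨heB, h0, h1⟩
        rw [hon e heB] at he
        tauto)) (by
      rintro (A | A) ht
      · simp only [Sum.elim_inl, sum_ind_mul] at ht ⊢
        exact hpt y hyp A ⟨A.2, by simpa using ht⟩
      · simp only [Sum.elim_inr, neg_mul, sum_neg_distrib, sum_ind_mul, neg_eq_zero] at ht ⊢
        refine hqt y (fun k => ?_) A ⟨A.2, by rw [sum_sub_distrib]; linarith⟩
        simpa using hyq k))
  set H := univ.filter fun e => x e = 1 with hH
  have hxH : x = ind H := by
    funext e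
    have := hint e
    by_cases h1 : x e = 1
    · simp [ind, hH, h1]
    · have h0 : x e = 0 := by
        by_cases heB : e ∈ B
        · tauto
        · exact hoff e heB
      simp [ind, hH, h0]
  have hHB : H ⊆ B := fun e he => by
    by_contra h
    have := (mem_filter.1 he).2
    rw [hoff e h] at this
    norm_num at this
  refine ⟨H, hHB, hxH ▸ hxb, ?_⟩
  convert hwb using 2 with e
  rw [hxH]
  by_cases h1 : e ∈ H
  · simp [ind, h1, hHB h1]
  · simp [ind, h1]

/-- A base of the `m`-fold union of the graphic matroid contains `m` disjoint spanning trees. -/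
theorem IsFracBase.exists_disjoint_trees [Fintype V] {m : ℕ} {B : Finset E}
    (hB : IsFracBase s t m (ind B)) :
    ∃ T : Fin m → Finset E, (∀ i, T i ⊆ B ∧ IsFracBase s t 1 (ind (T i))) ∧
      ∀ i j, i ≠ j → Disjoint (T i) (T j) := by
  induction m generalizing B with
  | zero => exact ⟨Fin.elim0, fun i => i.elim0, fun i => i.elim0⟩
  | succ m ih =>
    obtain ⟨H, hHB, hH, hH'⟩ := hB.exists_split
    obtain ⟨T, hT, hd⟩ := ih hH'
    refine ⟨Fin.cons H T, fun i => ?_, fun i j hij => ?_⟩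
    · cases i using Fin.cases with
      | zero => exact ⟨hHB, hH⟩
      | succ i => exact ⟨(hT i).1.trans sdiff_subset, (hT i).2⟩
    · have hdH : ∀ i, Disjoint H (T i) := fun i =>
        disjoint_sdiff.mono_right (hT i).1
      cases i using Fin.cases with
      | zero =>
        cases j using Fin.cases with
        | zero => exact absurd rfl hij
        | succ j => simpa using hdH j
      | succ i =>
        cases j using Fin.cases with
        | zero => simpa using (hdH i).symm
        | succ j => simpa using hd i j (fun h => hij (h ▸ rfl))

end EdgeSparse

/-! ### Degree bounds by counting, and fractional bases from packed trees. -/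

namespace EdgeSparse

open Finset

variable {V E : Type*} [Fintype E] [DecidableEq V] [DecidableEq E] {s t : E → V}

/-- The edges with at least one end in `S`. -/
def touching (s t : E → V) (S : Finset V) : Finset E := univ.filter fun e => s e ∈ S ∨ t e ∈ S

/-- The edges with exactly one end in `S`. -/
def crossing (s t : E → V) (S : Finset V) : Finset E :=
  univ.filter fun e => s e ∈ S ∧ t e ∉ S ∨ t e ∈ S ∧ s e ∉ S

lemma touching_eq_sdiff [Fintype V] (S : Finset V) :
    touching s t S = univ \ inside s t Sᶜ := by
  ext e
  simp only [touching, mem_filter, mem_univ, true_and, mem_sdiff, mem_inside, mem_compl]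
  tauto

lemma sum_sum_star (hst : ∀ e, s e ≠ t e) (S : Finset V) (g : E → ℝ) :
    ∑ v ∈ S, ∑ e ∈ star s t v, g e = ∑ e ∈ touching s t S, g e + ∑ e ∈ inside s t S, g e := by
  simp only [star, touching, inside, sum_filter]
  rw [sum_comm, ← sum_add_distrib]
  refine sum_congr rfl fun e _ => ?_
  have h : ∀ v, (if s e = v ∨ t e = v then g e else 0)
      = (if s e = v then g e else 0) + if t e = v then g e else 0 := by
    intro v
    by_cases h1 : s e = v
    · have h2 : t e ≠ v := fun h => hst e (h1.trans h.symm)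
      simp [h1, h2]
    · simp [h1]
  simp only [h, sum_add_distrib, sum_ite_eq]
  by_cases h1 : s e ∈ S <;> by_cases h2 : t e ∈ S <;> simp [h1, h2]

/-- Degree bounds for a base, derived from a fractional base whose weight near vertex sets is
controlled. -/
theorem exists_base_degree_le [Fintype V] (hst : ∀ e, s e ≠ t e) {m : ℕ} (hm : 0 < m) {z : E → ℝ}
    (hz : IsFracBase s t m z) (u : V) {q a l : ℝ} (hl0 : 0 ≤ l) (hl1 : l ≤ 1)
    (hzS : ∀ S : Finset V, ∑ e ∈ touching s t S, z e ≤
      a * #(S.erase u) + q * ∑ v ∈ S, (#(star s t v) : ℝ) - l * #(inside s t S))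
    {X : Set V} {h : V → ℤ} (hu : q * #(star s t u) < h u + 1)
    (hX : ∀ v ∈ X, v ≠ u → q * #(star s t v) + a + m * (1 - l) ≤ h v) :
    ∃ H : Finset E, IsFracBase s t m (ind H) ∧ ∀ v, v = u ∨ v ∈ X → degree s t H v ≤ h v := by
  classical
  -- The value `|E| + 1` exceeds every degree, so unconstrained vertices never enter `S`.
  rcases exists_base_degree_le_or hm hz
    (fun v => if v = u ∨ v ∈ X then h v else Fintype.card E + 1) with ⟨H, hH, hd⟩ | hbad
  · exact ⟨H, hH, fun v hv => by simpa [hv] using hd v⟩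
  exfalso
  obtain ⟨H, S, hH, hge, ⟨w, hwS, hw⟩, hle⟩ := hbad
  have hcard : ∀ v, degree s t H v ≤ Fintype.card E := fun v => by
    rw [degree]; exact_mod_cast card_le_univ _
  have hwX : w = u ∨ w ∈ X := by
    by_contra hc
    rw [if_neg hc] at hw
    have := hcard w
    omega
  rw [if_pos hwX] at hw
  have hHv : ∀ v, (degree s t H v : ℝ) = ∑ e ∈ star s t v, ind H e := fun v => by
    rw [sum_ind, degree]; norm_cast
  have hGv : ∀ v, (#(star s t v) : ℝ) = ∑ e ∈ star s t v, 1 := fun v => by simp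
  have hHS := sum_sum_star hst S (ind H)
  have hGS := sum_sum_star hst S (fun _ => 1)
  simp only [← hHv] at hHS
  simp only [← hGv] at hGS
  have hiH := hH.sparse S ⟨w, hwS⟩
  have hiG : ∑ e ∈ inside s t S, ind H e ≤ #(inside s t S) := by
    rw [sum_ind]; exact_mod_cast card_le_card inter_subset_right
  have htouch : ∑ e ∈ touching s t S, ind H e ≤ ∑ e ∈ touching s t S, z e := by
    have h1 := hH.tight.2
    have h2 := hz.tight.2
    rw [inside_univ, ← sum_sdiff (subset_univ (inside s t Sᶜ)), ← touching_eq_sdiff] at h1 h2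
    linarith
  have hz' := hzS S
  have hlower : q * ∑ v ∈ S, (#(star s t v) : ℝ) + #(S.erase u) * (a + m * (1 - l))
      < ∑ v ∈ S, (degree s t H v : ℝ) := by
    have hSX : ∀ v ∈ S, (v = u ∨ v ∈ X) ∧ h v ≤ degree s t H v := by
      intro v hv
      have h1 := hge v hv
      by_cases hvX : v = u ∨ v ∈ X
      · rw [if_pos hvX] at h1
        exact ⟨hvX, h1⟩
      · rw [if_neg hvX] at h1
        have := hcard v
        omega
    -- The unit gained by integrality at the overfull vertex pays for rounding down at `u` when `u ∈
    -- S`, and gives strictness otherwise.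
    have h1 : ∑ v ∈ S, h v + 1 ≤ ∑ v ∈ S, degree s t H v :=
      Int.add_one_le_iff.2 (sum_lt_sum (fun v hv => (hSX v hv).2) ⟨w, hwS, hw⟩)
    have h2 : (∑ v ∈ S, (h v : ℝ)) + 1 ≤ ∑ v ∈ S, (degree s t H v : ℝ) := by exact_mod_cast h1
    have h3 : ∑ v ∈ S.erase u, (q * #(star s t v) + (a + m * (1 - l)))
        ≤ ∑ v ∈ S.erase u, (h v : ℝ) := by
      refine sum_le_sum fun v hv => ?_
      rw [mem_erase] at hv
      have := hX v ((hSX v hv.2).1.resolve_left hv.1) hv.1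
      linarith
    rw [sum_add_distrib, ← mul_sum, sum_const, nsmul_eq_mul] at h3
    by_cases huS : u ∈ S
    · rw [← add_sum_erase S _ huS] at h2 ⊢
      linarith
    · rw [erase_eq_of_notMem huS] at h3 ⊢
      linarith
  have hc1 : (#S : ℝ) - 1 ≤ #(S.erase u) := by
    have := pred_card_le_card_erase (s := S) (a := u)
    have h2 : #S ≤ #(S.erase u) + 1 := by omega
    have h3 : (#S : ℝ) ≤ #(S.erase u) + 1 := by exact_mod_cast h2
    linarith
  -- The term `l * #(inside s t S)` is chosen to cancel the one in `hzS`.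
  have hi : ∑ e ∈ inside s t S, ind H e ≤ l * #(inside s t S) + (1 - l) * (m * #(S.erase u)) := by
    have h1 := mul_le_mul_of_nonneg_left hiG hl0
    have h2 := mul_le_mul_of_nonneg_left (hiH.trans (mul_le_mul_of_nonneg_left hc1 m.cast_nonneg))
      (sub_nonneg.2 hl1)
    linarith
  linarith

/-- Degree bounds for a base on an independent set of vertices. -/
theorem exists_base_degree_le_of_independent [Fintype V] {m : ℕ} {z : E → ℝ}
    (hz : IsFracBase s t m z) (u : V) {q a l : ℝ} (hl0 : 0 ≤ l) (ha : 0 ≤ a)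
    (hzS : ∀ S : Finset V, ∑ e ∈ touching s t S, z e ≤
      a * #(S.erase u) + q * ∑ v ∈ S, (#(star s t v) : ℝ) - l * #(inside s t S))
    {X : Set V} (hXi : ∀ e, ¬ (s e ∈ X ∧ t e ∈ X)) {h : V → ℤ} {b : ℤ}
    (hu : ∀ n : ℤ, n ≤ q * #(star s t u) → n ≤ b)
    (hX : ∀ v ∈ X, q * #(star s t v) + a ≤ h v) :
    ∃ H : Finset E, IsFracBase s t m (ind H) ∧ (∀ v ∈ X, degree s t H v ≤ h v) ∧
      degree s t H u ≤ b := by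
  classical
  have hstar : ∀ v, ∑ e ∈ star s t v, z e ≤ a * #(({v} : Finset V).erase u)
      + q * #(star s t v) := by
    intro v
    have h1 := hzS {v}
    have h2 : touching s t {v} = star s t v := by
      ext e; simp [touching]
    rw [h2, sum_singleton] at h1
    have h3 : 0 ≤ l * #(inside s t {v}) := mul_nonneg hl0 (Nat.cast_nonneg _)
    linarith
  obtain ⟨H, hH, hHX, hHu⟩ := exists_base_of_independent (X := univ.filter (· ∈ X))
    (by simpa using hXi) h hz (fun v hv => by
      have h1 : (#(({v} : Finset V).erase u) : ℝ) ≤ 1 := by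
        exact_mod_cast (card_le_card (erase_subset u {v})).trans_eq (card_singleton v)
      have h2 := mul_le_mul_of_nonneg_left h1 ha
      have h3 := hX v (by simpa using hv)
      linarith [hstar v]) u
  refine ⟨H, hH, by simpa using hHX, hu _ (hHu.trans ?_)⟩
  have := hstar u
  rw [erase_singleton] at this
  simpa using this

/-- A connected spanning set of edges contains a spanning tree. -/
lemma exists_tree_of_connected [Fintype V] [Nonempty V] {T : Finset E}
    (hT : ∀ A : Finset V, A.Nonempty → A ≠ univ → ∃ e ∈ T, e ∈ crossing s t A) :
    ∃ H ⊆ T, IsFracBase s t 1 (ind H) := by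
  classical
  obtain ⟨H, hHT, hH, hmax⟩ := exists_maximal_sparse (s := s) (t := t) 1 T
  obtain ⟨v₀⟩ := ‹Nonempty V›
  obtain ⟨A, -, hA⟩ := (univ.filter fun A => IsTight s t 1 (ind H) A).exists_le_maximal (a := {v₀})
    (by simpa using isTight_singleton (ind_nonneg H) hH v₀)
  have hAt : IsTight s t 1 (ind H) A := by simpa using hA.1
  have hAmax : ∀ B, IsTight s t 1 (ind H) B → A ⊆ B → B ⊆ A := fun B hB h =>
    (hA.eq_of_le (by simpa using hB) h).symm.subset
  by_cases hAu : A = univ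
  · exact ⟨H, hHT, ind_nonneg H, ind_le_one H, hH, hAu ▸ hAt⟩
  exfalso
  obtain ⟨e, heT, he⟩ := hT A hAt.1 hAu
  obtain ⟨v, hv, w, hw, hvw⟩ : ∃ v ∈ A, ∃ w ∉ A, s e = v ∧ t e = w ∨ t e = v ∧ s e = w := by
    rcases (mem_filter.1 he).2 with h | h
    · exact ⟨s e, h.1, t e, h.2, .inl ⟨rfl, rfl⟩⟩
    · exact ⟨t e, h.1, s e, h.2, .inr ⟨rfl, rfl⟩⟩
  -- `A` is a maximal tight set and `e` leaves it. If `e ∈ H`, adding its outer end keeps `A` tight;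
  -- if not, the tight set blocking `e` meets `A` and their union is tight.
  by_cases heH : e ∈ H
  · refine hw (hAmax (insert w A) ⟨insert_nonempty _ _, le_antisymm (hH _ (insert_nonempty _ _)) ?_⟩
      (subset_insert _ _) (mem_insert_self _ _))
    have heA : e ∉ inside s t A := by
      rw [mem_inside]
      rcases hvw with ⟨h1, h2⟩ | ⟨h1, h2⟩
      · exact fun h => hw (h2 ▸ h.2)
      · exact fun h => hw (h2 ▸ h.1)
    have hsub : insert e (inside s t A) ⊆ inside s t (insert w A) := by
      refine insert_subset ?_ (inside_mono (subset_insert _ _))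
      rw [mem_inside, mem_insert, mem_insert]
      rcases hvw with ⟨h1, h2⟩ | ⟨h1, h2⟩
      · exact ⟨.inr (h1 ▸ hv), .inl h2⟩
      · exact ⟨.inl h2, .inr (h1 ▸ hv)⟩
    have h1 := sum_le_sum_of_subset_of_nonneg hsub fun f _ _ => ind_nonneg H f
    rw [sum_insert heA, hAt.2] at h1
    rw [card_insert_of_notMem hw]
    have h2 : ind H e = 1 := by simp [ind, heH]
    push_cast at h1 ⊢
    linarith
  · obtain ⟨B, hB, heB⟩ := hmax e heT heH
    rw [mem_inside] at heB
    have hvB : v ∈ B ∧ w ∈ B := by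
      rcases hvw with ⟨h1, h2⟩ | ⟨h1, h2⟩
      · exact ⟨h1 ▸ heB.1, h2 ▸ heB.2⟩
      · exact ⟨h1 ▸ heB.2, h2 ▸ heB.1⟩
    exact hw (hAmax (A ∪ B) (hAt.uncross (ind_nonneg H) hH hB ⟨v, mem_inter.2 ⟨hv, hvB.1⟩⟩).1
      subset_union_left (mem_union_right _ hvB.2))

/-- Scaling a packing of `k` spanning trees. -/
lemma exists_isFracBase_of_trees [Fintype V] (hst : ∀ e, s e ≠ t e) {m k : ℕ} (hk : 0 < k)
    (hmk : m ≤ k)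
    {B : Fin k → Finset E} (hB : ∀ i, IsFracBase s t 1 (ind (B i)))
    (hd : ∀ i j, i ≠ j → Disjoint (B i) (B j)) :
    ∃ z : E → ℝ, IsFracBase s t m z ∧ ∀ S : Finset V, ∑ e ∈ touching s t S, z e ≤
      (m / k : ℝ) * ∑ v ∈ S, (#(star s t v) : ℝ) - (m / k : ℝ) * #(inside s t S) := by
  classical
  have hk' : (0 : ℝ) < k := by exact_mod_cast hk
  have hq : (0 : ℝ) ≤ m / k := by positivity
  have hq1 : (m / k : ℝ) ≤ 1 := by
    rw [div_le_one hk']; exact_mod_cast hmk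
  have hsum1 : ∀ e, ∑ i, ind (B i) e ≤ 1 := by
    intro e
    simp only [ind, sum_boole]
    have : #(univ.filter fun i => e ∈ B i) ≤ 1 := by
      rw [card_le_one]
      intro i hi j hj
      by_contra hij
      exact disjoint_left.1 (hd i j hij) (mem_filter.1 hi).2 (mem_filter.1 hj).2
    exact_mod_cast this
  have hzle : ∀ e, (m / k : ℝ) * ∑ i, ind (B i) e ≤ m / k := fun e =>
    mul_le_of_le_one_right hq (hsum1 e)
  have hswap : ∀ S : Finset E, ∑ e ∈ S, (m / k : ℝ) * ∑ i, ind (B i) e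
      = (m / k : ℝ) * ∑ i, ∑ e ∈ S, ind (B i) e := fun S => by
    rw [← mul_sum, sum_comm]
  have hmk' : ∀ r : ℝ, (m / k : ℝ) * ∑ _i : Fin k, r = m * r := fun r => by
    simp; field_simp
  have hV := (hB ⟨0, hk⟩).tight.1
  refine ⟨fun e => (m / k : ℝ) * ∑ i, ind (B i) e, ⟨fun e => ?_, fun e => (hzle e).trans hq1,
    fun A hA => ?_, hV, ?_⟩, fun S => ?_⟩
  · exact mul_nonneg hq (sum_nonneg fun i _ => ind_nonneg _ _)
  · rw [hswap, ← hmk']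
    refine mul_le_mul_of_nonneg_left (sum_le_sum fun i _ => ?_) hq
    simpa using (hB i).sparse A hA
  · rw [hswap, ← hmk']
    congr 1
    refine sum_congr rfl fun i _ => ?_
    simpa using (hB i).tight.2
  · have h1 := sum_sum_star hst S (fun _ => 1)
    have h2 : ∑ e ∈ touching s t S, (m / k : ℝ) * ∑ i, ind (B i) e
        ≤ ∑ e ∈ touching s t S, (m / k : ℝ) := sum_le_sum fun e _ => hzle e
    simp only [sum_const, nsmul_eq_mul, mul_one] at h1 h2
    rw [h1]
    linarith

end EdgeSparse

/-! ### Fractional bases from edge connectivity. -/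

namespace EdgeSparse

open Finset

/-- Arc weights under which every set of vertices avoiding the root `u` is entered by weight at
least `m` can be reduced until every vertex is entered by weight exactly `m`, and `u` by none. -/
lemma exists_arc_weights {V D : Type*} [Fintype V] [Fintype D] [DecidableEq V] [DecidableEq D]
    (hd tl : D → V) (c : D → ℝ) (hc : ∀ a, 0 ≤ c a) (u : V) {m : ℝ} (hm : 0 < m)
    (hcut : ∀ A : Finset V, A.Nonempty → u ∉ A → m ≤ ∑ a with hd a ∈ A ∧ tl a ∉ A, c a) :
    ∃ y : D → ℝ, (∀ a, 0 ≤ y a) ∧ (∀ a, y a ≤ c a) ∧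
      (∀ A : Finset V, A.Nonempty → u ∉ A → m ≤ ∑ a with hd a ∈ A ∧ tl a ∉ A, y a) ∧
      (∀ v, v ≠ u → ∑ a with hd a = v, y a = m) ∧ ∑ a with hd a = u, y a = 0 := by
  classical
  set Q : Set (D → ℝ) := Set.Icc 0 c ∩ {y | ∀ A : Finset V, A.Nonempty → u ∉ A →
    m ≤ ∑ a with hd a ∈ A ∧ tl a ∉ A, y a} with hQ
  have hQc : IsCompact Q := by
    refine isCompact_Icc.inter_right ?_
    simp only [Set.ofPred_forall]
    exact isClosed_iInter fun A => isClosed_iInter fun _ => isClosed_iInter fun _ =>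
      isClosed_le continuous_const (by fun_prop)
  obtain ⟨y, ⟨⟨hy0, hyc⟩, hycut⟩, hmin⟩ := hQc.exists_isMinOn ⟨c, ⟨hc, le_rfl⟩, hcut⟩
    (f := fun y => ∑ a, y a) (by fun_prop)
  have hy0 : ∀ a, 0 ≤ y a := hy0
  let P : Finset V → Prop := fun A =>
    A.Nonempty ∧ u ∉ A ∧ ∑ a with hd a ∈ A ∧ tl a ∉ A, y a = m
  -- By minimality of the total weight, an arc of positive weight enters a tight cut; otherwise its
  -- weight could be lowered slightly.
  have htight : ∀ a, 0 < y a → ∃ A, P A ∧ hd a ∈ A ∧ tl a ∉ A := by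
    intro a ha
    by_contra! hcon
    have hev : ∀ᶠ r : ℝ in nhds 0, r < y a ∧ ∀ A : Finset V, A.Nonempty → u ∉ A →
        m ≤ ∑ b with hd b ∈ A ∧ tl b ∉ A, (y b - r * Pi.single (M := fun _ => ℝ) a 1 b) := by
      refine (gt_mem_nhds ha).and ?_
      simp only [Filter.eventually_all]
      intro A hA hu
      by_cases haA : hd a ∈ A ∧ tl a ∉ A
      · have hlt : m < ∑ b with hd b ∈ A ∧ tl b ∉ A, y b :=
          (hycut A hA hu).lt_of_ne fun h => haA.2 (hcon A ⟨hA, hu, h.symm⟩ haA.1)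
        have hcont : Continuous fun r : ℝ => ∑ b with hd b ∈ A ∧ tl b ∉ A,
            (y b - r * Pi.single (M := fun _ => ℝ) a 1 b) := by fun_prop
        have := hcont.tendsto 0
        simp only [zero_mul, sub_zero] at this
        exact (this.eventually (lt_mem_nhds hlt)).mono fun r hr => hr.le
      · refine Filter.Eventually.of_forall fun r => (hycut A hA hu).trans_eq ?_
        refine sum_congr rfl fun b hb => ?_
        have hba : b ≠ a := fun h => haA (h ▸ (mem_filter.1 hb).2)
        simp [hba]
    obtain ⟨ε, hε, hball⟩ := Metric.eventually_nhds_iff.1 hev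
    obtain ⟨h1, h2⟩ := hball (y := ε / 2) (by
      rw [Real.dist_eq, sub_zero, abs_of_pos] <;> linarith)
    have h3 := hmin (a := fun b => y b - ε / 2 * Pi.single (M := fun _ => ℝ) a 1 b)
      ⟨⟨fun b => ?_, fun b => ?_⟩, h2⟩
    · simp only [Set.mem_ofPred_eq, sum_sub_distrib, ← mul_sum] at h3
      simp at h3
      linarith
    · by_cases hb : b = a
      · subst hb
        simp only [Pi.zero_apply, Pi.single_eq_same]
        linarith
      · simpa [Pi.single_apply, hb] using hy0 b
    · have h5 : 0 ≤ Pi.single (M := fun _ => ℝ) a 1 b := by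
        rw [Pi.single_apply]; split_ifs <;> simp
      have h6 : 0 ≤ ε / 2 * Pi.single (M := fun _ => ℝ) a 1 b := by positivity
      have := hyc b
      simp only at *
      linarith
  have hinter : ∀ A B, P A → P B → (A ∩ B).Nonempty → P (A ∩ B) := by
    rintro A B ⟨hA, huA, hAm⟩ ⟨hB, huB, hBm⟩ hAB
    have huAB : u ∉ A ∩ B := fun h => huA (mem_inter.1 h).1
    refine ⟨hAB, huAB, le_antisymm ?_ (hycut _ hAB huAB)⟩
    have h1 := hycut (A ∪ B) (hA.mono subset_union_left) (by simp [huA, huB])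
    have h2 : ∑ a with hd a ∈ A ∩ B ∧ tl a ∉ A ∩ B, y a + ∑ a with hd a ∈ A ∪ B ∧ tl a ∉ A ∪ B, y a
        ≤ ∑ a with hd a ∈ A ∧ tl a ∉ A, y a + ∑ a with hd a ∈ B ∧ tl a ∉ B, y a := by
      simp only [sum_filter, ← sum_add_distrib]
      refine sum_le_sum fun a _ => ?_
      have := hy0 a
      simp only [mem_inter, mem_union]
      by_cases h1 : hd a ∈ A <;> by_cases h2 : hd a ∈ B <;> by_cases h3 : tl a ∈ A <;>
        by_cases h4 : tl a ∈ B <;> simp [h1, h2, h3, h4, this]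
    linarith
  refine ⟨y, hy0, hyc, hycut, fun v hv => ?_, ?_⟩
  · have hge : m ≤ ∑ a with hd a = v, y a := by
      refine (hycut {v} (singleton_nonempty v) (by simpa using hv.symm)).trans ?_
      refine sum_le_sum_of_subset_of_nonneg (fun a ha => ?_) fun a _ _ => hy0 a
      simp only [mem_filter, mem_univ, true_and, mem_singleton] at *
      exact ha.1
    obtain ⟨a₀, ha₀, ha₀p⟩ : ∃ a, hd a = v ∧ 0 < y a := by
      by_contra! hcon
      have : ∑ a with hd a = v, y a ≤ 0 := sum_nonpos fun a ha => hcon a (mem_filter.1 ha).2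
      linarith
    obtain ⟨A₀, hA₀, hvA₀, -⟩ := htight a₀ ha₀p
    -- Every positive arc into `v` enters some tight set, which contains the least tight set `T`
    -- around `v`. So the arc enters `T` as well, and the weight into `v` is at most the weight `m`
    -- into `T`.
    obtain ⟨T, hT, hTmin⟩ := exists_min_image (univ.filter fun A => P A ∧ v ∈ A) card
      ⟨A₀, mem_filter.2 ⟨mem_univ _, hA₀, ha₀ ▸ hvA₀⟩⟩
    obtain ⟨hTP, hvT⟩ := (mem_filter.1 hT).2
    refine le_antisymm ?_ hge
    rw [← hTP.2.2, ← sum_filter_add_sum_filter_not _ fun a => 0 < y a]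
    have hz : ∑ a ∈ univ.filter (fun a => hd a = v) with ¬ 0 < y a, y a ≤ 0 :=
      sum_nonpos fun a ha => not_lt.1 (mem_filter.1 ha).2
    have hle : ∑ a ∈ univ.filter (fun a => hd a = v) with 0 < y a, y a
        ≤ ∑ a with hd a ∈ T ∧ tl a ∉ T, y a := by
      refine sum_le_sum_of_subset_of_nonneg (fun a ha => ?_) fun a _ _ => hy0 a
      simp only [mem_filter, mem_univ, true_and] at ha ⊢
      obtain ⟨B, hB, hhB, htB⟩ := htight a ha.2
      rw [ha.1] at hhB
      have hI := hinter T B hTP hB ⟨v, mem_inter.2 ⟨hvT, hhB⟩⟩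
      have hTB : T ⊆ B := inter_eq_left.1 (eq_of_subset_of_card_le inter_subset_left
        (hTmin _ (mem_filter.2 ⟨mem_univ _, hI, mem_inter.2 ⟨hvT, hhB⟩⟩)))
      exact ⟨ha.1 ▸ hvT, fun h => htB (hTB h)⟩
    linarith
  · refine sum_eq_zero fun a ha => ?_
    by_contra h
    obtain ⟨A, hA, hhA, -⟩ := htight a ((hy0 a).lt_of_ne' h)
    rw [(mem_filter.1 ha).2] at hhA
    exact hA.2.1 hhA

variable {V E : Type*} [Fintype E] [DecidableEq V] [DecidableEq E] {s t : E → V}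

/-- A fractional base from edge connectivity, by sending half of every edge in each direction. -/
lemma exists_isFracBase_of_edgeConnected [Fintype V] (hst : ∀ e, s e ≠ t e) {m k : ℕ} (hm : 0 < m)
    (hmk : 2 * m ≤ k) (hcut : ∀ A : Finset V, A.Nonempty → A ≠ univ → k ≤ #(crossing s t A))
    (u : V) :
    ∃ z : E → ℝ, IsFracBase s t m z ∧ ∀ S : Finset V, ∑ e ∈ touching s t S, z e ≤
      m * #(S.erase u) + (m / k : ℝ) * ∑ v ∈ S, (#(star s t v) : ℝ)
        - (2 * (m / k) : ℝ) * #(inside s t S) := by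
  classical
  have hm' : (0 : ℝ) < m := by exact_mod_cast hm
  have hk' : (0 : ℝ) < k := by exact_mod_cast (by omega : 0 < k)
  have hq : (0 : ℝ) ≤ m / k := by positivity
  have hq1 : 2 * (m / k : ℝ) ≤ 1 := by
    rw [← mul_div_assoc, div_le_one hk']; exact_mod_cast hmk
  obtain ⟨y, hy0, hyc, hycut, hyv, hyu⟩ := exists_arc_weights (D := E ⊕ E) (Sum.elim t s)
    (Sum.elim s t) (fun _ => (m / k : ℝ)) (fun _ => hq) u hm' (by
      intro A hA hu
      have h1 := hcut A hA fun h => hu (h ▸ mem_univ u)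
      have h2 : #(crossing s t A)
          = #(univ.filter fun a : E ⊕ E => Sum.elim t s a ∈ A ∧ Sum.elim s t a ∉ A) := by
        rw [card_filter, crossing, card_filter, Fintype.sum_sum_type, ← sum_add_distrib]
        refine sum_congr rfl fun e _ => ?_
        simp only [Sum.elim_inl, Sum.elim_inr]
        by_cases h1 : s e ∈ A <;> by_cases h2 : t e ∈ A <;> simp [h1, h2]
      rw [sum_const, ← h2, nsmul_eq_mul]
      have h3 : (k : ℝ) ≤ #(crossing s t A) := by exact_mod_cast h1
      calc (m : ℝ) = k * (m / k) := by field_simp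
        _ ≤ _ := mul_le_mul_of_nonneg_right h3 hq)
  have hin : ∀ S : Finset V, ∑ e, ((if t e ∈ S then y (.inl e) else 0)
      + if s e ∈ S then y (.inr e) else 0) = m * #(S.erase u) := by
    intro S
    have h1 : ∑ v ∈ S, ∑ a with Sum.elim t s a = v, y a = m * #(S.erase u) := by
      have h2 : ∑ v ∈ S.erase u, ∑ a with Sum.elim t s a = v, y a = m * #(S.erase u) := by
        rw [sum_congr rfl fun v hv => hyv v (mem_erase.1 hv).1, sum_const, nsmul_eq_mul, mul_comm]
      by_cases hu : u ∈ S
      · rw [← add_sum_erase S _ hu, hyu, zero_add, h2]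
      · rw [erase_eq_of_notMem hu] at h2 ⊢
        exact h2
    rw [← h1]
    simp only [sum_filter]
    rw [sum_comm, Fintype.sum_sum_type, sum_add_distrib]
    congr 1
    · exact sum_congr rfl fun e _ => (sum_ite_eq S (t e) fun _ => y (.inl e)).symm
    · exact sum_congr rfl fun e _ => (sum_ite_eq S (s e) fun _ => y (.inr e)).symm
  have hinto : ∀ S : Finset V, ∑ a with Sum.elim t s a ∈ S ∧ Sum.elim s t a ∉ S, y a
      = ∑ e, ((if t e ∈ S ∧ s e ∉ S then y (.inl e) else 0)
        + if s e ∈ S ∧ t e ∉ S then y (.inr e) else 0) := by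
    intro S
    rw [sum_filter, Fintype.sum_sum_type, sum_add_distrib]
    rfl
  -- Weight inside `S` is the weight into its vertices minus the weight entering `S` from outside.
  -- Sparsity follows: for `u ∉ S` at least `m` enters, and for `u ∈ S` the root itself receives
  -- nothing.
  have hins : ∀ S : Finset V, ∑ e ∈ inside s t S, (y (.inl e) + y (.inr e))
      = m * #(S.erase u) - ∑ a with Sum.elim t s a ∈ S ∧ Sum.elim s t a ∉ S, y a := by
    intro S
    rw [← hin, hinto, ← sum_sub_distrib, inside, sum_filter]
    refine sum_congr rfl fun e _ => ?_
    by_cases h1 : s e ∈ S <;> by_cases h2 : t e ∈ S <;> simp [h1, h2]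
  refine ⟨fun e => y (.inl e) + y (.inr e), ⟨fun e => add_nonneg (hy0 _) (hy0 _),
    fun e => by linarith [hyc (.inl e), hyc (.inr e)], fun A hA => ?_, ⟨u, mem_univ u⟩, ?_⟩,
    fun S => ?_⟩
  · rw [hins]
    by_cases hu : u ∈ A
    · rw [cast_card_erase_of_mem hu]
      have : 0 ≤ ∑ a with Sum.elim t s a ∈ A ∧ Sum.elim s t a ∉ A, y a :=
        sum_nonneg fun a _ => hy0 a
      linarith
    · have := hycut A hA hu
      rw [erase_eq_of_notMem hu]
      linarith
  · rw [hins, cast_card_erase_of_mem (mem_univ u)]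
    simp
  · have h1 := sum_sum_star hst S (fun _ => 1)
    simp only [sum_const, nsmul_eq_mul, mul_one] at h1
    rw [h1, ← hin]
    have h2 : (m / k : ℝ) * (#(touching s t S) + #(inside s t S)) - 2 * (m / k) * #(inside s t S)
        = ∑ e : E, if (s e ∈ S ∧ t e ∉ S ∨ t e ∈ S ∧ s e ∉ S) then (m / k : ℝ) else 0 := by
      have h3 : ∀ p : E → Prop, ∀ [DecidablePred p],
          (#(univ.filter p) : ℝ) = ∑ e, if p e then (1 : ℝ) else 0 := fun p _ => by simp
      have h4 : ∑ e : E, (if (s e ∈ S ∧ t e ∉ S ∨ t e ∈ S ∧ s e ∉ S) then (m / k : ℝ) else 0)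
          = (m / k : ℝ) * (#(touching s t S) - #(inside s t S)) := by
        rw [touching, inside, h3, h3, ← sum_sub_distrib, mul_sum]
        refine sum_congr rfl fun e _ => ?_
        by_cases h1 : s e ∈ S <;> by_cases h2 : t e ∈ S <;> simp [h1, h2]
      rw [h4]
      ring
    -- Edges touching `S` carry the weight into vertices of `S` plus the arcs leaving `S`, each of
    -- weight at most `m / k`.
    rw [add_sub_assoc, h2, ← sum_add_distrib, touching, sum_filter]
    refine sum_le_sum fun e _ => ?_
    have := hyc (.inl e)
    have := hyc (.inr e)
    by_cases h1 : s e ∈ S <;> by_cases h2 : t e ∈ S <;> simp [h1, h2] <;> linarith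

end EdgeSparse

/-! ### Transfer to `Graph`. -/

namespace Graph

open Finset EdgeSparse

variable {α β : Type*} {G : Graph α β}

lemma exists_ends (G : Graph α β) :
    ∃ s t : G.edgeSet → G.vertexSet, ∀ e, G.IsLink e.1 (s e).1 (t e).1 := by
  choose x y h using fun e : G.edgeSet => G.exists_isLink_of_mem_edgeSet e.2
  exact ⟨fun e => ⟨x e, (h e).left_mem⟩, fun e => ⟨y e, (h e).right_mem⟩, h⟩

/-- The spanning subgraph with the edges in `F`. -/
def spanning (G : Graph α β) (F : Finset G.edgeSet) : Graph α β :=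
  G.restrict (Subtype.val '' (F : Set G.edgeSet))

lemma spanning_isLink {F : Finset G.edgeSet} {e : β} {x y : α} :
    (G.spanning F).IsLink e x y ↔ ∃ h : e ∈ G.edgeSet, ⟨e, h⟩ ∈ F ∧ G.IsLink e x y := by
  constructor
  · rintro ⟨⟨f, hf, rfl⟩, h⟩
    exact ⟨f.2, hf, h⟩
  · rintro ⟨h, hF, hl⟩
    exact ⟨⟨⟨e, h⟩, hF, rfl⟩, hl⟩

lemma spanning_mono {F K : Finset G.edgeSet} (h : F ⊆ K) :
    (G.spanning F).IsSpanningSubgraph (G.spanning K) :=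
  ⟨restrict_mono_right G (Set.image_mono (by exact_mod_cast h)), rfl⟩

lemma spanning_isSpanningSubgraph (F : Finset G.edgeSet) :
    (G.spanning F).IsSpanningSubgraph G := ⟨restrict_le, rfl⟩

lemma mem_edgeSet_spanning {F : Finset G.edgeSet} {e : β} :
    e ∈ (G.spanning F).edgeSet ↔ ∃ h : e ∈ G.edgeSet, ⟨e, h⟩ ∈ F := by
  constructor
  · rintro ⟨-, f, hf, rfl⟩
    exact ⟨f.2, hf⟩
  · rintro ⟨h, hF⟩
    exact ⟨h, ⟨e, h⟩, hF, rfl⟩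

variable [Fintype G.vertexSet] [Fintype G.edgeSet] [DecidableEq G.vertexSet]
  [DecidableEq G.edgeSet] {s t : G.edgeSet → G.vertexSet}

lemma deg_spanning (hst : ∀ e, G.IsLink e.1 (s e).1 (t e).1) (F : Finset G.edgeSet)
    (v : G.vertexSet) : ((G.spanning F).deg v : ℤ) = degree s t F v := by
  have h : (G.spanning F).incidenceSet v.1 = Subtype.val '' (↑(F ∩ star s t v) : Set G.edgeSet) := by
    ext e
    rw [mem_incidenceSet]
    constructor
    · rintro ⟨y, hy⟩
      obtain ⟨he, hF, hl⟩ := spanning_isLink.1 hy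
      refine ⟨⟨e, he⟩, ?_, rfl⟩
      rw [mem_coe, mem_inter, mem_star]
      refine ⟨hF, ?_⟩
      rcases hl.left_eq_or_eq (hst ⟨e, he⟩) with h | h
      · exact .inl (Subtype.ext h.symm)
      · exact .inr (Subtype.ext h.symm)
    · rintro ⟨f, hf, rfl⟩
      rw [mem_coe, mem_inter, mem_star] at hf
      rcases hf.2 with h | h
      · exact ⟨t f, spanning_isLink.2 ⟨f.2, hf.1, h ▸ hst f⟩⟩
      · exact ⟨s f, spanning_isLink.2 ⟨f.2, hf.1, h ▸ (hst f).symm⟩⟩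
  rw [deg, h, Set.ncard_image_of_injective _ Subtype.val_injective, Set.ncard_coe_finset, degree]

lemma deg_eq_card_star (hst : ∀ e, G.IsLink e.1 (s e).1 (t e).1) (v : G.vertexSet) :
    G.deg v = #(star s t v) := by
  have h1 := deg_spanning hst univ v
  have h2 : G.spanning univ = G := by
    rw [spanning, restrict_eq_self_iff]
    exact fun e he => ⟨⟨e, he⟩, by simp, rfl⟩
  rw [h2, degree, univ_inter] at h1
  exact_mod_cast h1

lemma IsEdgeConnected.le_card_crossing (hst : ∀ e, G.IsLink e.1 (s e).1 (t e).1) {k : ℕ}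
    (hG : G.IsEdgeConnected k) (A : Finset G.vertexSet) (hA : A.Nonempty) (hA' : A ≠ univ) :
    k ≤ #(crossing s t A) := by
  have h := hG.2 (Subtype.val '' (A : Set G.vertexSet)) (by rintro _ ⟨v, -, rfl⟩; exact v.2)
    (by simpa using hA) (by
      intro h
      refine hA' (eq_univ_iff_forall.2 fun v => ?_)
      obtain ⟨w, hw, hwv⟩ := h.symm.subset v.2
      rw [← Subtype.ext hwv]
      exact hw)
  refine h.trans_eq ?_
  rw [← Set.ncard_coe_finset, ← Set.ncard_image_of_injective _ Subtype.val_injective]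
  congr 1
  ext e
  constructor
  · rintro ⟨_, ⟨x, hx, rfl⟩, y, hy, hl⟩
    refine ⟨⟨e, hl.edge_mem⟩, ?_, rfl⟩
    have hyA : ∀ w : G.vertexSet, y = w → w ∉ A := fun w hw hwA => hy ⟨w, hwA, hw.symm⟩
    rw [mem_coe, crossing, mem_filter]
    refine ⟨mem_univ _, ?_⟩
    rcases hl.eq_and_eq_or_eq_and_eq (hst ⟨e, hl.edge_mem⟩) with ⟨h1, h2⟩ | ⟨h1, h2⟩
    · exact .inl ⟨Subtype.ext h1 ▸ hx, hyA _ h2⟩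
    · exact .inr ⟨Subtype.ext h1 ▸ hx, hyA _ h2⟩
  · rintro ⟨f, hf, rfl⟩
    have hn : ∀ w : G.vertexSet, w ∉ A → (w : α) ∉ Subtype.val '' (A : Set G.vertexSet) := by
      rintro w hw ⟨w', hw', h⟩
      exact hw (Subtype.ext h ▸ hw')
    rw [mem_coe, crossing, mem_filter] at hf
    rcases hf.2 with ⟨h1, h2⟩ | ⟨h1, h2⟩
    · exact ⟨_, ⟨_, h1, rfl⟩, _, hn _ h2, hst f⟩
    · exact ⟨_, ⟨_, h1, rfl⟩, _, hn _ h2, (hst f).symm⟩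

/-- A connected spanning subgraph crosses every cut, so `exists_tree_of_connected` finds a base
within the edges of each tree. -/
lemma IsTreeConnected.exists_disjoint_bases (hst : ∀ e, G.IsLink e.1 (s e).1 (t e).1)
    {k : ℕ} (hG : G.IsTreeConnected k) (hV : G.vertexSet.Nonempty) :
    ∃ B : Fin k → Finset G.edgeSet, (∀ i, IsFracBase s t 1 (ind (B i))) ∧
      ∀ i j, i ≠ j → Disjoint (B i) (B j) := by
  classical
  obtain ⟨T, hT, hd⟩ := hG
  have := hV.to_subtype
  have hbase : ∀ i, ∃ H ⊆ univ.filter (fun e : G.edgeSet => e.1 ∈ (T i).edgeSet),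
      IsFracBase s t 1 (ind H) := by
    intro i
    refine exists_tree_of_connected fun A hA hA' => ?_
    by_contra! hcon
    obtain ⟨x, hx⟩ := hA
    refine hA' (eq_univ_iff_forall.2 fun y => ?_)
    have hVi := (hT i).1.vertexSet_eq
    have hxy := (hT i).2.1.2 x.1 (hVi.symm.subset x.2) y.1 (hVi.symm.subset y.2)
    have hstep : ∀ z, Relation.ReflTransGen (T i).Adj x.1 z → ∃ h : z ∈ G.vertexSet, ⟨z, h⟩ ∈ A := by
      intro z hz
      induction hz with
      | refl => exact ⟨x.2, hx⟩
      | @tail b c _ hbc ih =>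
        obtain ⟨hb, hbA⟩ := ih
        obtain ⟨e, he⟩ := hbc
        have heG := (hT i).1.le.isLink_mono he
        refine ⟨heG.right_mem, ?_⟩
        have hc := hcon ⟨e, heG.edge_mem⟩ (mem_filter.2 ⟨mem_univ _, he.edge_mem⟩)
        by_contra hcA
        refine hc (mem_filter.2 ⟨mem_univ _, ?_⟩)
        rcases heG.eq_and_eq_or_eq_and_eq (hst ⟨e, heG.edge_mem⟩) with ⟨h1, h2⟩ | ⟨h1, h2⟩
        · have h1 : ⟨b, hb⟩ = s ⟨e, heG.edge_mem⟩ := Subtype.ext h1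
          have h2 : ⟨c, heG.right_mem⟩ = t ⟨e, heG.edge_mem⟩ := Subtype.ext h2
          exact .inl ⟨h1 ▸ hbA, h2 ▸ hcA⟩
        · have h1 : ⟨b, hb⟩ = t ⟨e, heG.edge_mem⟩ := Subtype.ext h1
          have h2 : ⟨c, heG.right_mem⟩ = s ⟨e, heG.edge_mem⟩ := Subtype.ext h2
          exact .inr ⟨h1 ▸ hbA, h2 ▸ hcA⟩
    obtain ⟨_, h⟩ := hstep y hxy
    exact h
  choose B hB hBb using hbase
  refine ⟨B, hBb, fun i j hij => disjoint_left.2 fun e hi hj => ?_⟩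
  exact Set.disjoint_left.1 (hd i j hij) (mem_filter.1 (hB i hi)).2 (mem_filter.1 (hB j hj)).2

/-- If `F` were disconnected, a reachability class and its complement would hold all of `F`, at most
`|V| - 2` edges. A cycle would put as many edges as vertices inside its vertex set, against
sparsity. -/
lemma isTree_spanning (hst : ∀ e, G.IsLink e.1 (s e).1 (t e).1) {F : Finset G.edgeSet}
    (hF : IsFracBase s t 1 (ind F)) : (G.spanning F).IsTree := by
  classical
  refine ⟨⟨?_, fun x hx y hy => ?_⟩, ?_⟩
  · obtain ⟨v, -⟩ := hF.tight.1
    exact ⟨v.1, v.2⟩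
  · by_contra hxy
    set A : Finset G.vertexSet :=
      univ.filter fun v => Relation.ReflTransGen (G.spanning F).Adj x v.1 with hA
    have hxA : (⟨x, hx⟩ : G.vertexSet) ∈ A := mem_filter.2 ⟨mem_univ _, .refl⟩
    have hyA : (⟨y, hy⟩ : G.vertexSet) ∈ Aᶜ := mem_compl.2 fun h => hxy (mem_filter.1 h).2
    have h1 := hF.sparse A ⟨_, hxA⟩
    have h2 := hF.sparse Aᶜ ⟨_, hyA⟩
    have h3 := hF.tight.2
    have hiff : ∀ e ∈ F, s e ∈ A ↔ t e ∈ A := by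
      intro e he
      have hl : (G.spanning F).IsLink e.1 (s e).1 (t e).1 := spanning_isLink.2 ⟨e.2, he, hst e⟩
      simp only [hA, mem_filter, mem_univ, true_and]
      exact ⟨fun h => h.tail hl.adj, fun h => h.tail hl.symm.adj⟩
    have hdis : Disjoint (inside s t A) (inside s t Aᶜ) := disjoint_left.2 fun e h h' => by
      rw [mem_inside] at h h'
      exact mem_compl.1 h'.1 h.1
    have h4 : ∑ e ∈ inside s t univ, ind F e
        = ∑ e ∈ inside s t A, ind F e + ∑ e ∈ inside s t Aᶜ, ind F e := by
      rw [← sum_union hdis]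
      refine (sum_subset (by simp) fun e _ he => ?_).symm
      rw [ind, if_neg]
      intro heF
      have := hiff e heF
      simp only [mem_union, mem_inside, mem_compl] at he
      tauto
    have h5 : (#A : ℝ) + #Aᶜ = #(univ : Finset G.vertexSet) := by
      rw [card_univ]; exact_mod_cast card_add_card_compl A
    rw [h4, ← h5] at h3
    rw [Nat.cast_one] at h1 h2 h3
    linarith
  · rintro ⟨n, v, e, hv, he, hl⟩
    have hl' := fun i => (spanning_isLink.1 (hl i)).2.2
    let v' : Fin (n + 1) → G.vertexSet := fun i => ⟨v i, (hl' i).left_mem⟩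
    let e' : Fin (n + 1) → G.edgeSet := fun i => ⟨e i, (hl' i).edge_mem⟩
    have hv' : Function.Injective v' := fun i j h => hv (congrArg Subtype.val h)
    have he' : Function.Injective e' := fun i j h => he (congrArg Subtype.val h)
    have h1 := hF.sparse (univ.image v') ⟨v' 0, mem_image_of_mem _ (mem_univ 0)⟩
    rw [sum_ind, card_image_of_injective _ hv'] at h1
    have h2 : univ.image e' ⊆ F ∩ inside s t (univ.image v') := by
      intro f hf
      obtain ⟨i, -, rfl⟩ := mem_image.1 hf
      obtain ⟨hm, hiF, -⟩ := spanning_isLink.1 (hl i)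
      refine mem_inter.2 ⟨hiF, mem_inside.2 ?_⟩
      have hi : ∀ j, v' j ∈ univ.image v' := fun j => mem_image_of_mem _ (mem_univ j)
      rcases (hl' i).eq_and_eq_or_eq_and_eq (hst (e' i)) with ⟨h1, h2⟩ | ⟨h1, h2⟩
      · have h1 : v' i = s (e' i) := Subtype.ext h1
        have h2 : v' (i + 1) = t (e' i) := Subtype.ext h2
        exact ⟨h1 ▸ hi i, h2 ▸ hi (i + 1)⟩
      · have h1 : v' i = t (e' i) := Subtype.ext h1
        have h2 : v' (i + 1) = s (e' i) := Subtype.ext h2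
        exact ⟨h2 ▸ hi (i + 1), h1 ▸ hi i⟩
    have h3 := card_le_card h2
    rw [card_image_of_injective _ he'] at h3
    have h4 : (#(univ : Finset (Fin (n + 1))) : ℝ) ≤ #(F ∩ inside s t (univ.image v')) := by
      exact_mod_cast h3
    rw [Nat.cast_one] at h1
    linarith

lemma isTreeConnected_spanning (hst : ∀ e, G.IsLink e.1 (s e).1 (t e).1) {m : ℕ}
    {B : Finset G.edgeSet} (hB : IsFracBase s t m (ind B)) : (G.spanning B).IsTreeConnected m := by
  obtain ⟨T, hT, hd⟩ := hB.exists_disjoint_trees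
  refine ⟨fun i => G.spanning (T i), fun i => ⟨spanning_mono (hT i).1, isTree_spanning hst (hT i).2⟩,
    fun i j hij => Set.disjoint_left.2 fun e hi hj => ?_⟩
  obtain ⟨_, hi⟩ := mem_edgeSet_spanning.1 hi
  obtain ⟨_, hj⟩ := mem_edgeSet_spanning.1 hj
  exact disjoint_left.1 (hd i j hij) hi hj

/-- Degree bounds for an `m`-tree-connected spanning subgraph from a fractional base. -/
lemma exists_subgraph_degree_le [G.Loopless] (hst : ∀ e, G.IsLink e.1 (s e).1 (t e).1) {m : ℕ}
    (hm : 0 < m) {z : G.edgeSet → ℝ} (hz : IsFracBase s t m z) (u : G.vertexSet) {q : ℚ} {a l : ℝ}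
    (ha : 0 ≤ a) (hl0 : 0 ≤ l) (hl1 : l ≤ 1)
    (hzS : ∀ S : Finset G.vertexSet, ∑ e ∈ touching s t S, z e ≤
      a * #(S.erase u) + q * ∑ v ∈ S, (#(star s t v) : ℝ) - l * #(inside s t S))
    {X : Set α} (hXV : X ⊆ G.vertexSet) (h : α → ℤ)
    (hX : (∀ v ∈ X, q * G.deg v + a + m * (1 - l) ≤ h v) ∨
      G.IsIndependent X ∧ ∀ v ∈ X, q * G.deg v + a ≤ h v) :
    ∃ H : Graph α β, H.IsSpanningSubgraph G ∧ H.IsTreeConnected m ∧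
      (∀ v ∈ X, (H.deg v : ℤ) ≤ h v) ∧ (H.deg u : ℤ) ≤ ⌊q * (G.deg u : ℚ)⌋ := by
  classical
  have hdeg := deg_eq_card_star hst
  have hb1 : (⌊q * (G.deg u : ℚ)⌋ : ℝ) ≤ q * G.deg u := by
    exact_mod_cast Int.floor_le (q * (G.deg u : ℚ))
  have hb2 : (q * G.deg u : ℝ) < ⌊q * (G.deg u : ℚ)⌋ + 1 := by
    exact_mod_cast Int.lt_floor_add_one (q * (G.deg u : ℚ))
  suffices hB : ∃ B : Finset G.edgeSet, IsFracBase s t m (ind B) ∧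
      (∀ v : G.vertexSet, v.1 ∈ X → degree s t B v ≤ h v) ∧
      degree s t B u ≤ ⌊q * (G.deg u : ℚ)⌋ by
    obtain ⟨B, hB, hBX, hBu⟩ := hB
    refine ⟨G.spanning B, spanning_isSpanningSubgraph B, isTreeConnected_spanning hst hB,
      fun v hv => ?_, (deg_spanning hst B u).trans_le hBu⟩
    exact (deg_spanning hst B ⟨v, hXV hv⟩).trans_le (hBX ⟨v, hXV hv⟩ hv)
  rcases hX with hX | ⟨hXi, hX⟩
  · obtain ⟨B, hB, hBX⟩ := exists_base_degree_le (fun e h => (hst e).ne (congrArg Subtype.val h)) hm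
      hz u hl0 hl1 hzS (X := {v : G.vertexSet | v.1 ∈ X})
      (h := fun v => if v = u then ⌊q * (G.deg u : ℚ)⌋ else h v)
      (by rwa [if_pos rfl, ← hdeg]) (fun v hv hvu => by rw [if_neg hvu, ← hdeg]; exact hX v hv)
    refine ⟨B, hB, fun v hv => ?_, by simpa using hBX u (.inl rfl)⟩
    have h1 := hBX v (.inr hv)
    by_cases hvu : v = u
    -- When `u ∈ X`, the floor imposed at `u` is below the bound `h u`, since `a` and `m * (1 - l)`
    -- are nonnegative.
    · subst hvu
      rw [if_pos rfl] at h1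
      refine h1.trans ?_
      have h2 := hX v hv
      have h3 : (0 : ℝ) ≤ m * (1 - l) := mul_nonneg m.cast_nonneg (by linarith)
      have h4 : (⌊q * (G.deg v : ℚ)⌋ : ℝ) ≤ h v := by linarith
      exact_mod_cast h4
    · rwa [if_neg hvu] at h1
  · refine exists_base_degree_le_of_independent hz u hl0 ha hzS
      (X := {v : G.vertexSet | v.1 ∈ X}) (h := fun v => h v)
      (fun e he => hXi _ he.1 _ he.2 (hst e).adj) (fun n hn => ?_)
      fun v hv => by rw [← hdeg]; exact hX v hv
    rw [← hdeg] at hn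
    have h1 : (n : ℝ) < ⌊q * (G.deg u : ℚ)⌋ + 1 := hn.trans_lt hb2
    have h2 : n < ⌊q * (G.deg u : ℚ)⌋ + 1 := by exact_mod_cast h1
    omega

end Graph

/-! ### The four cases. -/

theorem mainTheorem4 {α β : Type*} (G : Graph α β) [G.Loopless]
    (hV : G.vertexSet.Finite) (hE : G.edgeSet.Finite)
    (X : Set α) (hX : X ⊆ G.vertexSet) (m k : ℕ) (hm : 0 < m) (hk : 0 < k) :
    (G.IsEdgeConnected k → 2 * m ≤ k →
      (∃ H : Graph α β, H.IsSpanningSubgraph G ∧ H.IsTreeConnected m ∧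
        ∀ v ∈ X, (H.deg v : ℤ) ≤ ⌈(m : ℚ) / k * ((G.deg v : ℚ) - 2 * m)⌉ + 2 * m) ∧
      (∀ u ∈ G.vertexSet, ∃ H : Graph α β, H.IsSpanningSubgraph G ∧ H.IsTreeConnected m ∧
        (∀ v ∈ X, (H.deg v : ℤ) ≤ ⌈(m : ℚ) / k * ((G.deg v : ℚ) - 2 * m)⌉ + 2 * m) ∧
        (H.deg u : ℤ) ≤ ⌊(m : ℚ) / k * (G.deg u : ℚ)⌋)) ∧
    (G.IsTreeConnected k → m ≤ k →
      (∃ H : Graph α β, H.IsSpanningSubgraph G ∧ H.IsTreeConnected m ∧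
        ∀ v ∈ X, (H.deg v : ℤ) ≤ ⌈(m : ℚ) / k * ((G.deg v : ℚ) - m)⌉ + m) ∧
      (∀ u ∈ G.vertexSet, ∃ H : Graph α β, H.IsSpanningSubgraph G ∧ H.IsTreeConnected m ∧
        (∀ v ∈ X, (H.deg v : ℤ) ≤ ⌈(m : ℚ) / k * ((G.deg v : ℚ) - m)⌉ + m) ∧
        (H.deg u : ℤ) ≤ ⌊(m : ℚ) / k * (G.deg u : ℚ)⌋)) ∧
    (G.IsEdgeConnected k → 2 * m ≤ k → G.IsIndependent X →
      (∃ H : Graph α β, H.IsSpanningSubgraph G ∧ H.IsTreeConnected m ∧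
        ∀ v ∈ X, (H.deg v : ℤ) ≤ ⌈(m : ℚ) / k * (G.deg v : ℚ)⌉ + m) ∧
      (∀ u ∈ G.vertexSet, ∃ H : Graph α β, H.IsSpanningSubgraph G ∧ H.IsTreeConnected m ∧
        (∀ v ∈ X, (H.deg v : ℤ) ≤ ⌈(m : ℚ) / k * (G.deg v : ℚ)⌉ + m) ∧
        (H.deg u : ℤ) ≤ ⌊(m : ℚ) / k * (G.deg u : ℚ)⌋)) ∧
    (G.IsTreeConnected k → m ≤ k → G.IsIndependent X →
      (∃ H : Graph α β, H.IsSpanningSubgraph G ∧ H.IsTreeConnected m ∧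
        ∀ v ∈ X, (H.deg v : ℤ) ≤ ⌈(m : ℚ) / k * (G.deg v : ℚ)⌉) ∧
      (∀ u ∈ G.vertexSet, ∃ H : Graph α β, H.IsSpanningSubgraph G ∧ H.IsTreeConnected m ∧
        (∀ v ∈ X, (H.deg v : ℤ) ≤ ⌈(m : ℚ) / k * (G.deg v : ℚ)⌉) ∧
        (H.deg u : ℤ) ≤ ⌊(m : ℚ) / k * (G.deg u : ℚ)⌋)) := by
  classical
  have := hV.fintype
  have := hE.fintype
  obtain ⟨s, t, hst⟩ := G.exists_ends
  have hne : ∀ e, s e ≠ t e := fun e h => (hst e).ne (congrArg Subtype.val h)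
  have hk' : (0 : ℝ) < k := by exact_mod_cast hk
  have hq : (0 : ℝ) ≤ m / k := by positivity
  have hcast : (((m : ℚ) / k : ℚ) : ℝ) = m / k := by push_cast; rfl
  have hany : ∀ h : α → ℤ, G.vertexSet.Nonempty →
      (∀ u ∈ G.vertexSet, ∃ H : Graph α β, H.IsSpanningSubgraph G ∧ H.IsTreeConnected m ∧
        (∀ v ∈ X, (H.deg v : ℤ) ≤ h v) ∧ (H.deg u : ℤ) ≤ ⌊(m : ℚ) / k * (G.deg u : ℚ)⌋) →
      (∃ H : Graph α β, H.IsSpanningSubgraph G ∧ H.IsTreeConnected m ∧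
        ∀ v ∈ X, (H.deg v : ℤ) ≤ h v) ∧
      (∀ u ∈ G.vertexSet, ∃ H : Graph α β, H.IsSpanningSubgraph G ∧ H.IsTreeConnected m ∧
        (∀ v ∈ X, (H.deg v : ℤ) ≤ h v) ∧ (H.deg u : ℤ) ≤ ⌊(m : ℚ) / k * (G.deg u : ℚ)⌋) := by
    rintro h ⟨u, hu⟩ hall
    obtain ⟨H, h1, h2, h3, -⟩ := hall u hu
    exact ⟨⟨H, h1, h2, h3⟩, hall⟩
  have hceil : ∀ r : ℚ, (r : ℝ) ≤ (⌈r⌉ : ℤ) := fun r => by exact_mod_cast Int.le_ceil r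
  -- Here `a = m` and `l = 2m / k`, and `(m/k) d + m + m (1 - 2m/k) = (m/k)(d - 2m) + 2m`.
  have hEC : G.IsEdgeConnected k → 2 * m ≤ k → ∀ h : α → ℤ,
      ((∀ v ∈ X, (((m : ℚ) / k : ℚ) : ℝ) * G.deg v + m + m * (1 - 2 * (m / k)) ≤ h v) ∨
        G.IsIndependent X ∧ ∀ v ∈ X, (((m : ℚ) / k : ℚ) : ℝ) * G.deg v + m ≤ h v) →
      ∀ u ∈ G.vertexSet, ∃ H : Graph α β, H.IsSpanningSubgraph G ∧ H.IsTreeConnected m ∧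
        (∀ v ∈ X, (H.deg v : ℤ) ≤ h v) ∧ (H.deg u : ℤ) ≤ ⌊(m : ℚ) / k * (G.deg u : ℚ)⌋ := by
    intro hG hmk h hh u hu
    obtain ⟨z, hz, hzS⟩ := EdgeSparse.exists_isFracBase_of_edgeConnected hne hm hmk
      (hG.le_card_crossing hst) ⟨u, hu⟩
    refine Graph.exists_subgraph_degree_le hst hm hz ⟨u, hu⟩ m.cast_nonneg (by positivity) ?_
      (by simpa only [hcast] using hzS) hX h hh
    rw [← mul_div_assoc, div_le_one hk']
    exact_mod_cast hmk
  -- Here `a = 0` and `l = m / k`, and `(m/k) d + m (1 - m/k) = (m/k)(d - m) + m`.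
  have hTC : G.IsTreeConnected k → m ≤ k → ∀ h : α → ℤ,
      ((∀ v ∈ X, (((m : ℚ) / k : ℚ) : ℝ) * G.deg v + 0 + m * (1 - m / k) ≤ h v) ∨
        G.IsIndependent X ∧ ∀ v ∈ X, (((m : ℚ) / k : ℚ) : ℝ) * G.deg v + 0 ≤ h v) →
      ∀ u ∈ G.vertexSet, ∃ H : Graph α β, H.IsSpanningSubgraph G ∧ H.IsTreeConnected m ∧
        (∀ v ∈ X, (H.deg v : ℤ) ≤ h v) ∧ (H.deg u : ℤ) ≤ ⌊(m : ℚ) / k * (G.deg u : ℚ)⌋ := by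
    intro hG hmk h hh u hu
    obtain ⟨B, hB, hd⟩ := hG.exists_disjoint_bases hst ⟨u, hu⟩
    obtain ⟨z, hz, hzS⟩ := EdgeSparse.exists_isFracBase_of_trees hne hk hmk hB hd
    refine Graph.exists_subgraph_degree_le hst hm hz ⟨u, hu⟩ le_rfl hq ?_
      (by simpa only [hcast, zero_mul, zero_add] using hzS) hX h hh
    rw [div_le_one hk']
    exact_mod_cast hmk
  have hne' : G.IsTreeConnected k → G.vertexSet.Nonempty := by
    rintro ⟨T, hT, -⟩
    obtain ⟨v, hv⟩ := (hT ⟨0, hk⟩).2.1.1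
    exact ⟨v, (hT ⟨0, hk⟩).1.vertexSet_eq ▸ hv⟩
  refine ⟨fun hG hmk => hany _ hG.1 (hEC hG hmk _ (.inl fun v _ => ?_)),
    fun hG hmk => hany _ (hne' hG) (hTC hG hmk _ (.inl fun v _ => ?_)),
    fun hG hmk hXi => hany _ hG.1 (hEC hG hmk _ (.inr ⟨hXi, fun v _ => ?_⟩)),
    fun hG hmk hXi => hany _ (hne' hG) (hTC hG hmk _ (.inr ⟨hXi, fun v _ => ?_⟩))⟩
  · have := hceil ((m : ℚ) / k * ((G.deg v : ℚ) - 2 * m))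
    push_cast at this ⊢
    linarith
  · have := hceil ((m : ℚ) / k * ((G.deg v : ℚ) - m))
    push_cast at this ⊢
    linarith
  · have := hceil ((m : ℚ) / k * (G.deg v : ℚ))
    push_cast at this ⊢
    linarith
  · have := hceil ((m : ℚ) / k * (G.deg v : ℚ))
    push_cast at this ⊢
    linarith
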